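/- Let $\mathcal M$ be the set of Borel probability measures on $\mathbb R^D$ with finite second moment, let $\Gamma(\mu,\nu)$ be the set of Borel measures on $\mathbb R^D\times\mathbb R^D$ with marginals $\mu,\nu\in\mathcal M$, let $W_2(\mu,\nu)=\bigl(\inf_{\gamma\in\Gamma(\mu,\nu)}\int|x-y|^2\,d\gamma\bigr)^{1/2}$ be the Wasserstein distance, and let $\Gamma_o(\mu,\nu)$ be the set of plans that achieve this infimum. For $\gamma\in\Gamma_o(\mu,\nu)$ the barycentric projections $\bar\gamma_\mu^\nu\in L^1(\mu;\mathbb R^D)$ and $\bar\gamma_\nu^\mu\in L^1(\nu;\mathbb R^D)$ are characterized (up to null sets) by $$\int\psi(x)\,\bar\gamma_\mu^\nu(x)\,d\mu(x)=\int\psi(x)\,y\,d\gamma(x,y),\qquad \int\psi(y)\,\bar\gamma_\nu^\mu(y)\,d\nu(y)=\int\psi(y)\,x\,d\gamma(x,y)\qquad\text{for all }\psi\in C_b(\mathbb R^D).$$ Let $T_\mu\mathcal M$ be the closure of $\{\nabla\varphi:\varphi\in C_c^\infty(\mathbb R^D)\}$ in $L^2(\mu;\mathbb R^D)$. For $F:\mathcal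 M\to[-\infty,\infty]$ and $\mu\in\mathcal M$ with $F(\mu)$ finite, the subdifferential $\partial_-F(\mu)$ is the set of $\xi\in L^2(\mu;\mathbb R^D)$ such that, as $W_2(\mu,\nu)\to0$, $$F(\nu)\ \ge\ F(\mu)+\sup_{\gamma\in\Gamma_o(\mu,\nu)}\int\langle\xi(x),y-x\rangle\,d\gamma(x,y)+o(W_2(\mu,\nu)),$$ and the superdifferential is $\partial^+F(\mu)=\{\xi:-\xi\in\partial_-(-F)(\mu)\}$; both are empty where $F$ is not finite. Let $H:\mathcal M\to(-\infty,\infty]$ be proper (not identically $+\infty$), let $\tau>0$, let $$H_\tau(\mu)=\inf_{\nu\in\mathcal M}\Bigl\{\tfrac1{2\tau}W_2(\mu,\nu)^2+H(\nu)\Bigr\}$$ be its Moreau–Yosida approximation, and let $J_\tau[\mu]$ be the set of $\nu\in\mathcal M$ with $H_\tau(\mu)=\frac1{2\tau}W_2(\mu,\nu)^2+H(\nu)$. Let $\mu_o\in\mathcal M$ and $\nu_o\in J_\tau[\mu_o]$. Then $\partial^+H_\tau(\mu_o)\neq\emptyset$ and $\partial_-H(\nu_o)\neq\emptyset$. Furthermore,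 for every $\gamma\in\Gamma_o(\mu_o,\nu_o)$, both barycentric projections of $\gamma$ exist and $$\frac{\mathrm{Id}-\bar\gamma_{\mu_o}^{\nu_o}}{\tau}\in\partial^+H_\tau(\mu_o)\cap T_{\mu_o}\mathcal M,\qquad \frac{\bar\gamma_{\nu_o}^{\mu_o}-\mathrm{Id}}{\tau}\in\partial_-H(\nu_o)\cap T_{\nu_o}\mathcal M.$$ -/

import Mathlib

open MeasureTheory
open scoped ENNReal BoundedContinuousFunction

namespace WassersteinMY

noncomputable section

/-- The Euclidean space `ℝ^D`. -/
abbrev Euc (D : ℕ) := EuclideanSpace ℝ (Fin D)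

/-- The Wasserstein space `𝓜`: Borel probability measures on `ℝ^D` with finite second moment. -/
def WSpace (D : ℕ) :=
  {μ : Measure (Euc D) // IsProbabilityMeasure μ ∧ ∫⁻ x, ‖x‖ₑ ^ 2 ∂μ < ∞}

variable {D : ℕ}

/-- `Γ(μ, ν)`: the Borel measures on `ℝ^D × ℝ^D` with marginals `μ` and `ν`. -/
def plans (μ ν : WSpace D) : Set (Measure (Euc D × Euc D)) :=
  {γ | γ.map Prod.fst = μ.1 ∧ γ.map Prod.snd = ν.1}

/-- The quadratic transport cost `∫ |x - y|² dγ(x, y)`. -/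
def cost (γ : Measure (Euc D × Euc D)) : ℝ≥0∞ :=
  ∫⁻ p, ‖p.1 - p.2‖ₑ ^ 2 ∂γ

/-- The Wasserstein distance `W₂(μ, ν)`. The infimum is finite because `μ` and `ν` have finite
second moments. -/
def W2 (μ ν : WSpace D) : ℝ :=
  Real.sqrt (⨅ γ ∈ plans μ ν, cost γ).toReal

/-- `Γₒ(μ, ν)`: the plans that achieve the infimum in the definition of `W₂(μ, ν)`. -/
def optimalPlans (μ ν : WSpace D) : Set (Measure (Euc D × Euc D)) :=
  {γ | γ ∈ plans μ ν ∧ cost γ = ⨅ γ' ∈ plans μ ν, cost γ'}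

/-- `b` is (a version of) the barycentric projection of `γ` with respect to its first marginal
`μ`: `∫ ψ(x) b(x) dμ(x) = ∫ ψ(x) y dγ(x, y)` for every bounded continuous `ψ`. -/
def IsBarycentricFst (γ : Measure (Euc D × Euc D)) (μ : WSpace D) (b : Euc D → Euc D) : Prop :=
  Integrable b μ.1 ∧
    ∀ ψ : Euc D →ᵇ ℝ, ∫ x, ψ x • b x ∂μ.1 = ∫ p, ψ p.1 • p.2 ∂γ

/-- `b` is (a version of) the barycentric projection of `γ` with respect to its second marginal
`ν`: `∫ ψ(y) b(y) dν(y) = ∫ ψ(y) x dγ(x, y)` for every bounded continuous `ψ`. -/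
def IsBarycentricSnd (γ : Measure (Euc D × Euc D)) (ν : WSpace D) (b : Euc D → Euc D) : Prop :=
  Integrable b ν.1 ∧
    ∀ ψ : Euc D →ᵇ ℝ, ∫ y, ψ y • b y ∂ν.1 = ∫ p, ψ p.2 • p.1 ∂γ

/-- The Hilbert space `L²(μ)` of vector fields. -/
abbrev L2 (μ : WSpace D) := Lp (Euc D) 2 μ.1

/-- The tangent space `T_μ 𝓜`: the closure in `L²(μ)` of the gradients of functions in
`C_c^∞(ℝ^D)`. -/
def tangentSpace (μ : WSpace D) : Set (L2 μ) :=
  closure {f : L2 μ | ∃ φ : Euc D → ℝ,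
    ContDiff ℝ ((⊤ : ℕ∞) : WithTop ℕ∞) φ ∧ HasCompactSupport φ ∧ f =ᵐ[μ.1] gradient φ}

/-- The functional `H` takes values in `(-∞, ∞]` and its effective domain is not empty. -/
def Proper (H : WSpace D → EReal) : Prop :=
  (∀ ν, H ν ≠ ⊥) ∧ ∃ ν, H ν ≠ ⊤

/-- The subdifferential `∂₋H(μ)`, at a point `μ` where `H` is finite: all `ξ ∈ L²(μ)` with
`H(ν) ≥ H(μ) + sup_{γ ∈ Γₒ(μ, ν)} ∫ ⟨ξ(x), y - x⟩ dγ(x, y) + o(W₂(μ, ν))` as `ν → μ`. -/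
def subdifferential (H : WSpace D → EReal) (μ : WSpace D) : Set (L2 μ) :=
  {ξ | H μ ≠ ⊥ ∧ H μ ≠ ⊤ ∧ ∀ ε : ℝ, 0 < ε → ∃ δ : ℝ, 0 < δ ∧ ∀ ν : WSpace D, W2 μ ν < δ →
    H μ + (⨆ γ ∈ optimalPlans μ ν, ((∫ p, inner ℝ (ξ p.1) (p.2 - p.1) ∂γ : ℝ) : EReal))
      ≤ H ν + ((ε * W2 μ ν : ℝ) : EReal)}

/-- The superdifferential: `ξ ∈ ∂⁺H(μ)` if and only if `-ξ ∈ ∂₋(-H)(μ)`. -/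
def superdifferential (H : WSpace D → EReal) (μ : WSpace D) : Set (L2 μ) :=
  {ξ | -ξ ∈ subdifferential (fun ν => -H ν) μ}

/-- The Moreau-Yosida approximation `H_τ(μ) = inf_ν {W₂(μ, ν)² / (2τ) + H(ν)}`. -/
def moreauYosida (τ : ℝ) (H : WSpace D → EReal) (μ : WSpace D) : EReal :=
  ⨅ ν : WSpace D, ((1 / (2 * τ) * W2 μ ν ^ 2 : ℝ) : EReal) + H ν

/-- `J_τ[μ]`: the minimizers in the definition of `H_τ(μ)`. -/
def minimizers (τ : ℝ) (H : WSpace D → EReal) (μ : WSpace D) : Set (WSpace D) :=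
  {ν | moreauYosida τ H μ = ((1 / (2 * τ) * W2 μ ν ^ 2 : ℝ) : EReal) + H ν}

end

end WassersteinMY

open ProbabilityTheory

namespace WassersteinMY

noncomputable section

open Filter Topology

variable {D : ℕ}

/-! Sub- and superdifferential. Glue a plan `γ` from `μ` to `ν` and a plan `σ` from `μ` to `ρ` along
`μ`, with conditional independence given `x`. Forgetting `x` leaves a competitor between `ρ` and
`ν`; expanding its cost gives `W2_sq_le_of_plans`, where `γ` enters the linear term only through its
barycentric projection, and the remainder is the cost of `σ`. Using `νₒ` as a competitor at a moved
base point gives the supergradient of `H_τ`; using a moved point as a competitor at the fixed base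
point `μₒ` gives the subgradient of `H`.

Tangency. It is enough that the identity and the barycentric projection `b` are orthogonal in
`L²(μ)` to each `w` orthogonal to all test gradients, that is, with `w μ` divergence free. The case
`ρ = μ` of the expansion yields `PlanMonotone`: `∫ ⟨b(x), y - x⟩ dσ ≤ 0` for every plan from `μ` to
itself. Were `w` a smooth field, the pairs (point, point moved by the flow of `w` for a short time)
would form such a plan, and the derivative in time would be `∫ ⟨b, w⟩ dμ`. Without regularity the
flow is replaced by a coupling (`FlowMonotone.mul_integral_inner_le`): blur `z` to `z - h a`, once
with `a` uniform in a ball and once with its density tilted by `1 + ⟨∇κ(a), w(z)⟩`. Since `w` is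
divergence free, both blurred laws agree, so the two can be glued there; the resulting displacement
has mean drift of order `h` along `w`. Dividing by `h` gives `∫ ⟨b, w⟩ ≤ 0`, and `-w` gives
equality.

The tilt needs `|w| ≤ 1`, so `w μ` is rewritten as `w' m` with `w' = w / (1 + |w|)` and `m = (1 +
|w|) μ`. The density of `m` may be unbounded, so monotonicity must reach measures whose marginals
are merely absolutely continuous with respect to `μ`. This goes through cyclical monotonicity of the
support of the graph of `b` and Rockafellar's potential (`PlanMonotone.integral_nonpos`). -/

theorem integrable_inner_of_memLp {α E : Type*} [MeasurableSpace α] [NormedAddCommGroup E]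
    [InnerProductSpace ℝ E] {μ : Measure α} {f g : α → E} (hf : MemLp f 2 μ) (hg : MemLp g 2 μ) :
    Integrable (fun x => inner ℝ (f x) (g x)) μ := by
  have h : Integrable (fun x => ‖f x‖ * ‖g x‖) μ := hf.norm.integrable_mul hg.norm
  refine h.mono (hf.1.inner hg.1) (Filter.Eventually.of_forall fun x => ?_)
  rw [Real.norm_of_nonneg (by positivity : 0 ≤ ‖f x‖ * ‖g x‖)]
  exact norm_inner_le_norm _ _

/-! ### Gluing of measures along a common marginal -/

section Glue

variable {X Y Z : Type*} [MeasurableSpace X] [MeasurableSpace Y] [MeasurableSpace Z]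
  [StandardBorelSpace Z] [Nonempty Z]

/-- The gluing of a measure `ρ` on `X × Y` and a measure `σ` on `X × Z` along `X`: given the
point of `X`, the points of `Y` and `Z` are independent. -/
def glue (ρ : Measure (X × Y)) (σ : Measure (X × Z)) [IsFiniteMeasure σ] :
    Measure ((X × Y) × Z) :=
  ρ ⊗ₘ (σ.condKernel.comap Prod.fst measurable_fst)

instance (ρ : Measure (X × Y)) (σ : Measure (X × Z)) [IsFiniteMeasure σ] [IsFiniteMeasure ρ] :
    IsFiniteMeasure (glue ρ σ) := by
  unfold glue; infer_instance

theorem map_fst_glue (ρ : Measure (X × Y)) (σ : Measure (X × Z)) [IsFiniteMeasure σ]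
    [IsFiniteMeasure ρ] : (glue ρ σ).map Prod.fst = ρ :=
  Measure.fst_compProd ρ _

/-- The kernel in `glue` sees only the `X`-coordinate, so equality of the `X`-marginals lets the
disintegration of `σ` recombine. -/
theorem map_snd_glue (ρ : Measure (X × Y)) (σ : Measure (X × Z)) [IsFiniteMeasure σ]
    [IsFiniteMeasure ρ] (h : ρ.map Prod.fst = σ.map Prod.fst) :
    (glue ρ σ).map (fun q => (q.1.1, q.2)) = σ := by
  have hm : Measurable (fun q : (X × Y) × Z => (q.1.1, q.2)) := by fun_prop
  refine Measure.ext_of_lintegral _ fun f hf => ?_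
  rw [lintegral_map hf hm, glue,
    Measure.lintegral_compProd (f := fun q : (X × Y) × Z => f (q.1.1, q.2)) (hf.comp hm)]
  simp only [Kernel.comap_apply]
  have h1 : Measurable fun x => ∫⁻ z, f (x, z) ∂σ.condKernel x :=
    Measurable.lintegral_kernel_prod_right' hf
  rw [← lintegral_map (f := fun x => ∫⁻ z, f (x, z) ∂σ.condKernel x) h1 measurable_fst, h]
  exact Measure.lintegral_condKernel hf

end Glue

/-! ### Barycentric projections by disintegration -/

section Barycenter

variable {X Y E : Type*} [MeasurableSpace X] [MeasurableSpace Y]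
  [NormedAddCommGroup E] [InnerProductSpace ℝ E] [FiniteDimensional ℝ E] [MeasurableSpace E]
  [BorelSpace E]

/-- The barycentric projection of a measure on `X × E` to its first factor. -/
def bary (γ : Measure (X × E)) [IsFiniteMeasure γ] (x : X) : E := ∫ z, z ∂γ.condKernel x

variable (γ : Measure (X × E)) [IsFiniteMeasure γ]

theorem stronglyMeasurable_bary : StronglyMeasurable (bary γ) :=
  StronglyMeasurable.integral_kernel_prod_right' (f := fun p : X × E => p.2)
    measurable_snd.stronglyMeasurable

/-- Jensen's inequality on each fibre, in the form that the `L¹` norm is at most the `L²` norm for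
the probability measure `γ.condKernel x`. -/
theorem memLp_bary (h : MemLp (fun p : X × E => p.2) 2 γ) :
    MemLp (bary γ) 2 (γ.map Prod.fst) := by
  refine ⟨(stronglyMeasurable_bary γ).aestronglyMeasurable, ?_⟩
  have h2 := h.2
  rw [eLpNorm_lt_top_iff_lintegral_rpow_enorm_lt_top (by norm_num) (by norm_num)] at h2 ⊢
  refine lt_of_le_of_lt ?_ h2
  rw [← Measure.lintegral_condKernel (ρ := γ) (f := fun p => ‖p.2‖ₑ ^ (2 : ℝ≥0∞).toReal)
    (by fun_prop)]
  refine lintegral_mono fun x => ?_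
  calc ‖bary γ x‖ₑ ^ (2 : ℝ≥0∞).toReal
      ≤ (∫⁻ z, ‖z‖ₑ ∂γ.condKernel x) ^ (2 : ℝ≥0∞).toReal := by
        gcongr; exact enorm_integral_le_lintegral_enorm _
    _ = (eLpNorm (fun z : E => z) 1 (γ.condKernel x)) ^ (2 : ℝ≥0∞).toReal := by
        rw [eLpNorm_one_eq_lintegral_enorm]
    _ ≤ (eLpNorm (fun z : E => z) 2 (γ.condKernel x)) ^ (2 : ℝ≥0∞).toReal := by
        gcongr
        exact eLpNorm_le_eLpNorm_of_exponent_le (by norm_num) (by fun_prop)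
    _ = _ := by
        rw [eLpNorm_eq_lintegral_rpow_enorm_toReal (by norm_num) (by norm_num), ← ENNReal.rpow_mul]
        norm_num

theorem integral_smul_bary {ψ : X → ℝ} (hψ : Measurable ψ) {C : ℝ} (hC : ∀ x, |ψ x| ≤ C)
    (h : Integrable (fun p : X × E => p.2) γ) :
    ∫ x, ψ x • bary γ x ∂γ.map Prod.fst = ∫ p, ψ p.1 • p.2 ∂γ := by
  have hi : Integrable (fun p : X × E => ψ p.1 • p.2) γ :=
    h.bdd_smul (φ := fun p => ψ p.1) C
      (hψ.comp measurable_fst).aestronglyMeasurable (Filter.Eventually.of_forall fun p => hC p.1)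
  rw [← Measure.integral_condKernel (ρ := γ) hi]
  exact integral_congr_ae (Filter.Eventually.of_forall fun x => (integral_smul _ _).symm)

/-- Given `q.1`, the law of `q.2` is the conditional law of `γ` at `q.1.1`; integrating `q.2` out
first leaves its mean. -/
theorem integral_inner_glue (ρ : Measure (X × Y)) [IsFiniteMeasure ρ]
    (h : ρ.map Prod.fst = γ.map Prod.fst) (hγ : MemLp (fun p : X × E => p.2) 2 γ)
    {φ : X × Y → E} (hφ : MemLp φ 2 ρ) :
    ∫ q, inner ℝ q.2 (φ q.1) ∂glue ρ γ = ∫ p, inner ℝ (bary γ p.1) (φ p) ∂ρ := by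
  have hm : Measurable (fun q : (X × Y) × E => (q.1.1, q.2)) := by fun_prop
  have h1 : MemLp (fun q : (X × Y) × E => q.2) 2 (glue ρ γ) := by
    have := hγ
    rw [← map_snd_glue ρ γ h] at this
    exact (memLp_map_measure_iff this.1 hm.aemeasurable).1 this
  have h2 : MemLp (fun q : (X × Y) × E => φ q.1) 2 (glue ρ γ) := by
    have := hφ
    rw [← map_fst_glue ρ γ] at this
    exact (memLp_map_measure_iff this.1 measurable_fst.aemeasurable).1 this
  have hi : Integrable (fun q : (X × Y) × E => inner ℝ q.2 (φ q.1)) (glue ρ γ) :=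
    integrable_inner_of_memLp h1 h2
  have hz : Integrable (fun q : (X × Y) × E => q.2) (glue ρ γ) := h1.integrable (by norm_num)
  rw [glue] at hi hz ⊢
  rw [Measure.integral_compProd hi]
  refine integral_congr_ae ?_
  have := hz.ae_of_compProd
  filter_upwards [(Measure.integrable_compProd_iff hz.1).1 hz |>.1] with p hp
  rw [bary]
  simp only [Kernel.comap_apply] at hp ⊢
  rw [real_inner_comm, ← integral_inner hp]
  simp only [real_inner_comm]

end Barycenter

/-- Smooth compactly supported tests already determine the projection, so any version may be
exchanged for `bary γ`. -/
theorem IsBarycentricFst.ae_eq {γ : Measure (Euc D × Euc D)} {μ : WSpace D} {b b' : Euc D → Euc D}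
    (hb : IsBarycentricFst γ μ b) (hb' : IsBarycentricFst γ μ b') : b =ᵐ[μ.1] b' := by
  refine ae_eq_of_integral_contDiff_smul_eq hb.1.locallyIntegrable hb'.1.locallyIntegrable
    fun g hg hc => ?_
  obtain ⟨C, hC⟩ := hc.exists_bound_of_continuous hg.continuous
  let ψ : Euc D →ᵇ ℝ := BoundedContinuousFunction.ofNormedAddCommGroup g hg.continuous C hC
  exact (hb.2 ψ).trans (hb'.2 ψ).symm

theorem WSpace.memLp (μ : WSpace D) : MemLp (fun x => x) 2 μ.1 := by
  refine ⟨by fun_prop, ?_⟩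
  rw [eLpNorm_lt_top_iff_lintegral_rpow_enorm_lt_top (by norm_num) (by norm_num)]
  simpa using μ.2.2

instance (μ : WSpace D) : IsProbabilityMeasure μ.1 := μ.2.1

/-! ### Transport plans, `W2`, and the first-order expansion -/

section Plans

variable {μ ν ρ : WSpace D} {γ σ : Measure (Euc D × Euc D)}

theorem isProbabilityMeasure_of_mem_plans (h : γ ∈ plans μ ν) : IsProbabilityMeasure γ := by
  constructor
  have := congrArg (fun m : Measure (Euc D) => m Set.univ) h.1
  simpa [Measure.map_apply measurable_fst] using this

theorem memLp_fst_of_mem_plans (h : γ ∈ plans μ ν) : MemLp (fun p => p.1) 2 γ := by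
  have := μ.memLp
  rw [← h.1] at this
  exact (memLp_map_measure_iff this.1 measurable_fst.aemeasurable).1 this

theorem memLp_snd_of_mem_plans (h : γ ∈ plans μ ν) : MemLp (fun p => p.2) 2 γ := by
  have := ν.memLp
  rw [← h.2] at this
  exact (memLp_map_measure_iff this.1 measurable_snd.aemeasurable).1 this

theorem map_swap_mem_plans (h : γ ∈ plans μ ν) : γ.map Prod.swap ∈ plans ν μ := by
  refine ⟨?_, ?_⟩
  · rw [Measure.map_map measurable_fst measurable_swap]; exact h.2
  · rw [Measure.map_map measurable_snd measurable_swap]; exact h.1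

theorem cost_map_swap (γ : Measure (Euc D × Euc D)) : cost (γ.map Prod.swap) = cost γ := by
  rw [cost, lintegral_map (by fun_prop) measurable_swap, cost]
  refine lintegral_congr fun p => ?_
  rw [Prod.fst_swap, Prod.snd_swap, ← enorm_neg, neg_sub]

theorem iInf_cost_comm (μ ν : WSpace D) : ⨅ γ ∈ plans μ ν, cost γ = ⨅ γ ∈ plans ν μ, cost γ := by
  have key : ∀ μ ν : WSpace D, ⨅ γ ∈ plans ν μ, cost γ ≤ ⨅ γ ∈ plans μ ν, cost γ :=
    fun μ ν => le_iInf₂ fun γ hγ =>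
      (iInf₂_le (γ.map Prod.swap) (map_swap_mem_plans hγ)).trans_eq (cost_map_swap γ)
  exact le_antisymm (key ν μ) (key μ ν)

theorem W2_comm (μ ν : WSpace D) : W2 μ ν = W2 ν μ := by
  rw [W2, iInf_cost_comm, W2]

theorem map_swap_mem_optimalPlans (h : γ ∈ optimalPlans μ ν) :
    γ.map Prod.swap ∈ optimalPlans ν μ :=
  ⟨map_swap_mem_plans h.1, by rw [cost_map_swap, h.2, iInf_cost_comm]⟩

theorem toReal_cost (γ : Measure (Euc D × Euc D)) :
    (cost γ).toReal = ∫ p, ‖p.1 - p.2‖ ^ 2 ∂γ := by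
  rw [integral_eq_lintegral_of_nonneg_ae (Filter.Eventually.of_forall fun p => by positivity)
    (by fun_prop), cost]
  congr 1
  refine lintegral_congr fun p => ?_
  rw [ENNReal.ofReal_pow (norm_nonneg _), ofReal_norm]

theorem cost_ne_top (h : γ ∈ plans μ ν) : cost γ ≠ ∞ := by
  have h2 := ((memLp_fst_of_mem_plans h).sub (memLp_snd_of_mem_plans h)).2
  rw [eLpNorm_lt_top_iff_lintegral_rpow_enorm_lt_top (by norm_num) (by norm_num)] at h2
  simpa [cost] using h2.ne

theorem W2_nonneg (μ ν : WSpace D) : 0 ≤ W2 μ ν := Real.sqrt_nonneg _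

theorem W2_sq (μ ν : WSpace D) : W2 μ ν ^ 2 = (⨅ γ ∈ plans μ ν, cost γ).toReal :=
  Real.sq_sqrt ENNReal.toReal_nonneg

theorem W2_sq_le (h : γ ∈ plans μ ν) : W2 μ ν ^ 2 ≤ ∫ p, ‖p.1 - p.2‖ ^ 2 ∂γ := by
  rw [W2_sq, ← toReal_cost]
  exact ENNReal.toReal_mono (cost_ne_top h) (iInf₂_le γ h)

theorem W2_sq_eq (h : γ ∈ optimalPlans μ ν) : W2 μ ν ^ 2 = ∫ p, ‖p.1 - p.2‖ ^ 2 ∂γ := by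
  rw [W2_sq, ← toReal_cost, h.2]

theorem memLp_bary_of_mem_plans [IsFiniteMeasure γ] (h : γ ∈ plans μ ν) :
    MemLp (bary γ) 2 μ.1 := by
  have := memLp_bary γ (memLp_snd_of_mem_plans h)
  rwa [h.1] at this

theorem isBarycentricFst_bary [IsFiniteMeasure γ] (h : γ ∈ plans μ ν) :
    IsBarycentricFst γ μ (bary γ) := by
  refine ⟨(memLp_bary_of_mem_plans h).integrable (by norm_num), fun ψ => ?_⟩
  rw [← h.1]
  exact integral_smul_bary γ ψ.continuous.measurable (C := ‖ψ‖) ψ.norm_coe_le_norm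
    ((memLp_snd_of_mem_plans h).integrable (by norm_num))

/-- Swapping the factors reduces everything about the second marginal to the first. -/
theorem isBarycentricSnd_iff {c : Euc D → Euc D} :
    IsBarycentricSnd γ ν c ↔ IsBarycentricFst (γ.map Prod.swap) ν c := by
  refine and_congr Iff.rfl (forall_congr' fun ψ => ?_)
  rw [integral_map measurable_swap.aemeasurable
    (by have := ψ.continuous; exact Continuous.aestronglyMeasurable (by fun_prop))]
  rfl

/-- The first-order upper bound for the squared distance from `ν` when `μ` is moved to `ρ`. -/
theorem W2_sq_le_of_plans [IsFiniteMeasure γ] (hγ : γ ∈ plans μ ν) (hσ : σ ∈ plans μ ρ) :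
    W2 ρ ν ^ 2 ≤ (∫ p, ‖p.1 - p.2‖ ^ 2 ∂γ) +
      2 * (∫ p, inner ℝ (p.1 - bary γ p.1) (p.2 - p.1) ∂σ) + ∫ p, ‖p.1 - p.2‖ ^ 2 ∂σ := by
  have := isProbabilityMeasure_of_mem_plans hσ
  have hm : Measurable (fun q : (Euc D × Euc D) × Euc D => (q.1.1, q.2)) := by fun_prop
  have hm' : Measurable (fun q : (Euc D × Euc D) × Euc D => (q.1.2, q.2)) := by fun_prop
  have heq : σ.map Prod.fst = γ.map Prod.fst := hσ.1.trans hγ.1.symm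
  set Θ := glue σ γ with hΘ
  have m1 : Θ.map Prod.fst = σ := map_fst_glue σ γ
  have m2 : Θ.map (fun q => (q.1.1, q.2)) = γ := map_snd_glue σ γ heq
  -- A point of the glued space is `((x, r), y)`, with `(x, r)` distributed by `σ` and `(x, y)` by
  -- `γ`; dropping `x` leaves the competitor.
  have hplan : Θ.map (fun q => (q.1.2, q.2)) ∈ plans ρ ν := by
    refine ⟨?_, ?_⟩
    · rw [Measure.map_map measurable_fst hm', ← hσ.2, ← m1,
        Measure.map_map measurable_snd measurable_fst]
      rfl
    · rw [Measure.map_map measurable_snd hm', ← hγ.2, ← m2, Measure.map_map measurable_snd hm]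
      rfl
  have l1 : MemLp (fun q : (Euc D × Euc D) × Euc D => q.1.1) 2 Θ := by
    have := memLp_fst_of_mem_plans hσ
    rw [← m1] at this
    exact (memLp_map_measure_iff this.1 measurable_fst.aemeasurable).1 this
  have l2 : MemLp (fun q : (Euc D × Euc D) × Euc D => q.1.2) 2 Θ := by
    have := memLp_snd_of_mem_plans hσ
    rw [← m1] at this
    exact (memLp_map_measure_iff this.1 measurable_fst.aemeasurable).1 this
  have l3 : MemLp (fun q : (Euc D × Euc D) × Euc D => q.2) 2 Θ := by
    have := memLp_snd_of_mem_plans hγ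
    rw [← m2] at this
    exact (memLp_map_measure_iff this.1 hm.aemeasurable).1 this
  have i1 : ∫ p, ‖p.1 - p.2‖ ^ 2 ∂γ = ∫ q, ‖q.1.1 - q.2‖ ^ 2 ∂Θ := by
    conv_lhs => rw [← m2]
    rw [integral_map hm.aemeasurable (by fun_prop)]
  have i2 : ∫ p, ‖p.1 - p.2‖ ^ 2 ∂σ = ∫ q, ‖q.1.1 - q.1.2‖ ^ 2 ∂Θ := by
    conv_lhs => rw [← m1]
    rw [integral_map measurable_fst.aemeasurable (by fun_prop)]
  have hφ : MemLp (fun p : Euc D × Euc D => p.2 - p.1) 2 σ :=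
    (memLp_snd_of_mem_plans hσ).sub (memLp_fst_of_mem_plans hσ)
  have i3 : ∫ q, inner ℝ q.2 (q.1.2 - q.1.1) ∂Θ = ∫ p, inner ℝ (bary γ p.1) (p.2 - p.1) ∂σ :=
    integral_inner_glue γ σ heq (memLp_snd_of_mem_plans hγ) hφ
  have i4 : ∫ q, inner ℝ q.1.1 (q.1.2 - q.1.1) ∂Θ = ∫ p, inner ℝ p.1 (p.2 - p.1) ∂σ := by
    conv_rhs => rw [← m1]
    rw [integral_map measurable_fst.aemeasurable (by fun_prop)]
  have hb : MemLp (fun p : Euc D × Euc D => bary γ p.1) 2 σ := by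
    have := memLp_bary_of_mem_plans hγ
    rw [← hσ.1] at this
    exact (memLp_map_measure_iff this.1 measurable_fst.aemeasurable).1 this
  have i5 : ∫ p, inner ℝ (p.1 - bary γ p.1) (p.2 - p.1) ∂σ =
      (∫ q, inner ℝ q.1.1 (q.1.2 - q.1.1) ∂Θ) - ∫ q, inner ℝ q.2 (q.1.2 - q.1.1) ∂Θ := by
    rw [i3, i4, ← integral_sub (integrable_inner_of_memLp (memLp_fst_of_mem_plans hσ) hφ)
      (integrable_inner_of_memLp hb hφ)]
    simp only [inner_sub_left]
  have j1 : Integrable (fun q : (Euc D × Euc D) × Euc D => ‖q.1.1 - q.2‖ ^ 2) Θ :=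
    (memLp_two_iff_integrable_sq_norm (l1.sub l3).1).1 (l1.sub l3)
  have j2 : Integrable (fun q : (Euc D × Euc D) × Euc D => ‖q.1.1 - q.1.2‖ ^ 2) Θ :=
    (memLp_two_iff_integrable_sq_norm (l1.sub l2).1).1 (l1.sub l2)
  have j3 : Integrable (fun q : (Euc D × Euc D) × Euc D => inner ℝ q.1.1 (q.1.2 - q.1.1)) Θ :=
    integrable_inner_of_memLp l1 (l2.sub l1)
  have j4 : Integrable (fun q : (Euc D × Euc D) × Euc D => inner ℝ q.2 (q.1.2 - q.1.1)) Θ :=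
    integrable_inner_of_memLp l3 (l2.sub l1)
  have j5 : Integrable (fun q : (Euc D × Euc D) × Euc D =>
      2 * (inner ℝ q.1.1 (q.1.2 - q.1.1) - inner ℝ q.2 (q.1.2 - q.1.1) : ℝ)) Θ :=
    (j3.sub j4).const_mul 2
  have j6 : Integrable (fun q : (Euc D × Euc D) × Euc D => ‖q.1.1 - q.2‖ ^ 2 +
      2 * (inner ℝ q.1.1 (q.1.2 - q.1.1) - inner ℝ q.2 (q.1.2 - q.1.1) : ℝ)) Θ := j1.add j5
  refine (W2_sq_le hplan).trans_eq ?_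
  rw [integral_map hm'.aemeasurable (by fun_prop), i1, i2, i5, ← integral_sub j3 j4,
    ← integral_const_mul, ← integral_add j1 j5,
    ← integral_add j6 j2]
  refine integral_congr_ae (Filter.Eventually.of_forall fun q => ?_)
  dsimp only
  rw [← inner_sub_left]
  have : q.1.2 - q.2 = (q.1.1 - q.2) - (q.1.1 - q.1.2) := by abel
  rw [this, norm_sub_sq_real]
  have : q.1.2 - q.1.1 = -(q.1.1 - q.1.2) := by abel
  rw [this, inner_neg_right]
  ring

end Plans

/-! ### Super- and subgradients from a minimizer -/

section Differentials

variable {μ ν ρ : WSpace D} {γ : Measure (Euc D × Euc D)}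

theorem integral_inner_congr_fst (hσ : σ ∈ plans μ ρ) {f g : Euc D → Euc D} (h : f =ᵐ[μ.1] g)
    (φ : Euc D × Euc D → Euc D) :
    ∫ p, inner ℝ (f p.1) (φ p) ∂σ = ∫ p, inner ℝ (g p.1) (φ p) ∂σ := by
  rw [← hσ.1] at h
  refine integral_congr_ae ?_
  filter_upwards [ae_of_ae_map measurable_fst.aemeasurable h] with p hp
  rw [hp]

/-- Reduces the supremum over optimal plans in `EReal` to one real inequality per plan. -/
theorem coe_add_iSup_le {α : Type*} {S : Set α} {F : α → ℝ} {a : ℝ} {y : EReal}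
    (hy : y ≠ ⊥) (h : ∀ s ∈ S, ((a + F s : ℝ) : EReal) ≤ y) :
    (a : EReal) + ⨆ s ∈ S, (F s : EReal) ≤ y := by
  induction y with
  | bot => exact absurd rfl hy
  | top => exact le_top
  | coe y =>
    have : ⨆ s ∈ S, (F s : EReal) ≤ ((y - a : ℝ) : EReal) := by
      refine iSup₂_le fun s hs => ?_
      have := EReal.coe_le_coe_iff.1 (h s hs)
      exact EReal.coe_le_coe_iff.2 (by linarith)
    calc (a : EReal) + ⨆ s ∈ S, (F s : EReal) ≤ (a : EReal) + ((y - a : ℝ) : EReal) := by gcongr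
      _ = y := by rw [← EReal.coe_add]; congr 1; ring

variable {H : WSpace D → EReal} {τ : ℝ}

theorem exists_coe_eq_of_mem_minimizers (hH : Proper H) (hν : ν ∈ minimizers τ H μ) :
    ∃ h : ℝ, H ν = h := by
  obtain ⟨hbot, ν', hν'⟩ := hH
  refine ⟨(H ν).toReal, (EReal.coe_toReal (fun htop => ?_) (hbot ν)).symm⟩
  have h1 : moreauYosida τ H μ ≤ ((1 / (2 * τ) * W2 μ ν' ^ 2 : ℝ) : EReal) + H ν' := iInf_le _ ν'
  rw [hν, htop, EReal.coe_add_top, top_le_iff] at h1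
  lift H ν' to ℝ using ⟨hν', hbot ν'⟩ with k
  rw [← EReal.coe_add] at h1
  exact EReal.coe_ne_top _ h1

/-- Absorbs the quadratic remainder of the expansion into the error `ε W₂`; this dictates the radius
`2 * τ * ε` in both differentials. -/
theorem mul_sq_le_mul_of_lt (hτ : 0 < τ) {ε w : ℝ} (hw : 0 ≤ w) (h : w < 2 * τ * ε) :
    1 / (2 * τ) * w ^ 2 ≤ ε * w := by
  have : w / (2 * τ) ≤ ε := by rw [div_le_iff₀ (by positivity)]; linarith
  calc 1 / (2 * τ) * w ^ 2 = w / (2 * τ) * w := by ring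
    _ ≤ ε * w := by gcongr

/-- If `ν` minimizes in the definition of `H_τ(μ)`, then `(Id - b) / τ` is a supergradient of
`H_τ` at `μ`, for the barycentric projection `b` of any optimal plan between `μ` and `ν`. -/
theorem mem_superdifferential (hH : Proper H) (hτ : 0 < τ) (hν : ν ∈ minimizers τ H μ)
    (hγ : γ ∈ optimalPlans μ ν) [IsFiniteMeasure γ] {ξ : L2 μ}
    (hξ : ξ =ᵐ[μ.1] fun x => τ⁻¹ • (x - bary γ x)) :
    ξ ∈ superdifferential (moreauYosida τ H) μ := by
  obtain ⟨h, hh⟩ := exists_coe_eq_of_mem_minimizers hH hν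
  have hmin : moreauYosida τ H μ = ((1 / (2 * τ) * W2 μ ν ^ 2 + h : ℝ) : EReal) := by
    rw [hν, hh, EReal.coe_add]
  refine ⟨?_, ?_, fun ε hε => ⟨2 * τ * ε, by positivity, fun ρ hρ => ?_⟩⟩
  · simp only [hmin, ← EReal.coe_neg]; exact EReal.coe_ne_bot _
  · simp only [hmin, ← EReal.coe_neg]; exact EReal.coe_ne_top _
  -- The minimizer `ν` for `μ` stays an admissible competitor for the moved point `ρ`.
  have hle : moreauYosida τ H ρ ≤ ((1 / (2 * τ) * W2 ρ ν ^ 2 + h : ℝ) : EReal) := by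
    refine (iInf_le _ ν).trans_eq ?_
    rw [hh, EReal.coe_add]
  have hle' : ((-(1 / (2 * τ) * W2 ρ ν ^ 2 + h) : ℝ) : EReal) ≤ -moreauYosida τ H ρ := by
    rw [EReal.coe_neg]; exact EReal.neg_le_neg_iff.2 hle
  have hbd : ((-(1 / (2 * τ) * W2 ρ ν ^ 2 + h) + ε * W2 μ ρ : ℝ) : EReal) ≤
      -moreauYosida τ H ρ + ((ε * W2 μ ρ : ℝ) : EReal) := by
    rw [EReal.coe_add]; gcongr
  simp only [hmin, ← EReal.coe_neg]
  refine coe_add_iSup_le ?_ fun σ hσ => le_trans (EReal.coe_le_coe_iff.2 ?_) hbd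
  · exact ((EReal.bot_lt_coe _).trans_le hbd).ne'
  have key := W2_sq_le_of_plans hγ.1 hσ.1
  rw [← W2_sq_eq hγ, ← W2_sq_eq hσ] at key
  have hξ' : (-ξ : L2 μ) =ᵐ[μ.1] fun x => -τ⁻¹ • (x - bary γ x) := by
    filter_upwards [Lp.coeFn_neg ξ, hξ] with x h1 h2
    rw [h1, Pi.neg_apply, h2, neg_smul]
  rw [integral_inner_congr_fst hσ.1 hξ']
  simp only [inner_smul_left, integral_const_mul]
  have hq := mul_sq_le_mul_of_lt hτ (W2_nonneg μ ρ) hρ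
  have key' := mul_le_mul_of_nonneg_left key (by positivity : 0 ≤ 1 / (2 * τ))
  set I := ∫ p, inner ℝ (p.1 - bary γ p.1) (p.2 - p.1) ∂σ
  have e : 1 / (2 * τ) * (W2 μ ν ^ 2 + 2 * I + W2 μ ρ ^ 2) =
      1 / (2 * τ) * W2 μ ν ^ 2 + τ⁻¹ * I + 1 / (2 * τ) * W2 μ ρ ^ 2 := by
    field_simp
  rw [e] at key'
  simp only [map_neg, conj_trivial]
  linarith

/-- If `ν` minimizes in the definition of `H_τ(μ)`, then `(c - Id) / τ` is a subgradient of `H`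
at `ν`, for the barycentric projection `c` of any optimal plan between `ν` and `μ`. -/
theorem mem_subdifferential (hH : Proper H) (hτ : 0 < τ) (hν : ν ∈ minimizers τ H μ)
    (hγ : γ ∈ optimalPlans ν μ) [IsFiniteMeasure γ] {ξ : L2 ν}
    (hξ : ξ =ᵐ[ν.1] fun x => τ⁻¹ • (bary γ x - x)) :
    ξ ∈ subdifferential H ν := by
  obtain ⟨h, hh⟩ := exists_coe_eq_of_mem_minimizers hH hν
  have hmin : moreauYosida τ H μ = ((1 / (2 * τ) * W2 μ ν ^ 2 + h : ℝ) : EReal) := by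
    rw [hν, hh, EReal.coe_add]
  refine ⟨hH.1 ν, by rw [hh]; exact EReal.coe_ne_top _,
    fun ε hε => ⟨2 * τ * ε, by positivity, fun ρ hρ => ?_⟩⟩
  by_cases htop : H ρ = ⊤
  · rw [htop, EReal.top_add_coe]; exact le_top
  -- Now the base point `μ` is fixed, and the perturbation `ρ` of `ν` is the competitor.
  have hle : moreauYosida τ H μ ≤ ((1 / (2 * τ) * W2 μ ρ ^ 2 : ℝ) : EReal) + H ρ := iInf_le _ ρ
  obtain ⟨k, hk⟩ : ∃ k : ℝ, H ρ = k := ⟨_, (EReal.coe_toReal htop (hH.1 ρ)).symm⟩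
  rw [hk, hmin, ← EReal.coe_add, EReal.coe_le_coe_iff] at hle
  rw [hk, hh, ← EReal.coe_add]
  refine coe_add_iSup_le (EReal.coe_ne_bot _) fun σ hσ => EReal.coe_le_coe_iff.2 ?_
  have key := W2_sq_le_of_plans hγ.1 hσ.1
  rw [← W2_sq_eq hγ, ← W2_sq_eq hσ, W2_comm ρ μ, W2_comm ν μ] at key
  have hξ' : ξ =ᵐ[ν.1] fun x => -τ⁻¹ • (x - bary γ x) := by
    filter_upwards [hξ] with x h2
    rw [h2, neg_smul, ← smul_neg, neg_sub]
  rw [integral_inner_congr_fst hσ.1 hξ']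
  simp only [inner_smul_left, integral_const_mul]
  have hq := mul_sq_le_mul_of_lt hτ (W2_nonneg ν ρ) hρ
  have key' := mul_le_mul_of_nonneg_left key (by positivity : 0 ≤ 1 / (2 * τ))
  set I := ∫ p, inner ℝ (p.1 - bary γ p.1) (p.2 - p.1) ∂σ
  have e : 1 / (2 * τ) * (W2 μ ν ^ 2 + 2 * I + W2 ν ρ ^ 2) =
      1 / (2 * τ) * W2 μ ν ^ 2 + τ⁻¹ * I + 1 / (2 * τ) * W2 ν ρ ^ 2 := by
    field_simp
  rw [e] at key'
  simp only [map_neg, conj_trivial]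
  linarith

end Differentials

/-! ### Existence of optimal plans -/

section Existence

theorem prod_mem_plans (μ ν : WSpace D) : μ.1.prod ν.1 ∈ plans μ ν := by
  refine ⟨?_, ?_⟩ <;> simp [Measure.map_fst_prod, Measure.map_snd_prod]

/-- The truncated costs are bounded and continuous, hence weakly continuous in `γ`; their supremum
is then lower semicontinuous. -/
theorem cost_eq_iSup (γ : Measure (Euc D × Euc D)) :
    cost γ = ⨆ n : ℕ, ∫⁻ p, min (‖p.1 - p.2‖ₑ ^ 2) n ∂γ := by
  rw [cost, ← lintegral_iSup (f := fun (n : ℕ) (p : Euc D × Euc D) => min (‖p.1 - p.2‖ₑ ^ 2) n)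
    (fun n => by fun_prop) (fun m n hmn p => min_le_min le_rfl (by exact_mod_cast hmn))]
  refine lintegral_congr fun p => ?_
  refine le_antisymm ?_ (iSup_le fun n => min_le_left _ _)
  obtain ⟨n, hn⟩ := ENNReal.exists_nat_gt (r := ‖p.1 - p.2‖ₑ ^ 2)
    (by simp [ENNReal.pow_eq_top_iff])
  exact le_iSup_of_le n (le_min le_rfl hn.le)

theorem lowerSemicontinuous_cost :
    LowerSemicontinuous fun γ : ProbabilityMeasure (Euc D × Euc D) => cost γ.1 := by
  simp_rw [cost_eq_iSup]
  refine lowerSemicontinuous_iSup fun n => Continuous.lowerSemicontinuous ?_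
  let f : (Euc D × Euc D) → NNReal := fun p => min (‖p.1 - p.2‖₊ ^ 2) n
  have hf : Continuous f := by fun_prop
  let F : (Euc D × Euc D) →ᵇ NNReal := BoundedContinuousFunction.mkOfBound ⟨f, hf⟩ n fun p q => by
    rw [NNReal.dist_eq, abs_le]
    have h1 : (f p : ℝ) ≤ n := by exact_mod_cast min_le_right _ _
    have h2 : (f q : ℝ) ≤ n := by exact_mod_cast min_le_right _ _
    have h3 := (f p).2
    have h4 := (f q).2
    simp only [ContinuousMap.coe_mk]
    constructor <;> linarith
  refine continuous_iff_continuousAt.2 fun γ => ?_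
  have h := (ProbabilityMeasure.tendsto_iff_forall_lintegral_tendsto (F := 𝓝 γ) (μs := id)).1
    tendsto_id F
  have e : ∀ p, min (‖p.1 - p.2‖ₑ ^ 2) (n : ℝ≥0∞) = (F p : ℝ≥0∞) := fun p => by
    simp [F, f, enorm_eq_nnnorm]
  simp_rw [e]
  exact h

/-- The direct method: plans with fixed marginals are tight and weakly closed, hence compact by
Prokhorov. This is what makes both differentials nonempty. -/
theorem exists_mem_optimalPlans (μ ν : WSpace D) : (optimalPlans μ ν).Nonempty := by
  let S : Set (ProbabilityMeasure (Euc D × Euc D)) := {γ | γ.1 ∈ plans μ ν}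
  have hclosed : IsClosed S := by
    let m : ProbabilityMeasure (Euc D) := ⟨μ.1, inferInstance⟩
    let n : ProbabilityMeasure (Euc D) := ⟨ν.1, inferInstance⟩
    have h1 : IsClosed {γ : ProbabilityMeasure (Euc D × Euc D) |
        γ.map measurable_fst.aemeasurable = m} :=
      isClosed_eq (ProbabilityMeasure.continuous_map continuous_fst) continuous_const
    have h2 : IsClosed {γ : ProbabilityMeasure (Euc D × Euc D) |
        γ.map measurable_snd.aemeasurable = n} :=
      isClosed_eq (ProbabilityMeasure.continuous_map continuous_snd) continuous_const
    convert h1.inter h2 using 1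
    ext γ
    exact and_congr (Subtype.ext_iff (a1 := γ.map measurable_fst.aemeasurable) (a2 := m)).symm
      (Subtype.ext_iff (a1 := γ.map measurable_snd.aemeasurable) (a2 := n)).symm
  have htight : IsTightMeasureSet {x | ∃ γ ∈ S, (γ : Measure (Euc D × Euc D)) = x} := by
    refine IsTightMeasureSet.prodMk ?_ ?_
    · refine (isTightMeasureSet_singleton (μ := μ.1)).subset ?_
      rintro _ ⟨_, ⟨γ, hγ, rfl⟩, rfl⟩
      exact hγ.1
    · refine (isTightMeasureSet_singleton (μ := ν.1)).subset ?_
      rintro _ ⟨_, ⟨γ, hγ, rfl⟩, rfl⟩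
      exact hγ.2
  have hcomp : IsCompact S := by
    have := isCompact_closure_of_isTightMeasureSet htight
    rwa [hclosed.closure_eq] at this
  have hne : S.Nonempty := ⟨⟨μ.1.prod ν.1, inferInstance⟩, prod_mem_plans μ ν⟩
  obtain ⟨γ, hγ, hmin⟩ := (lowerSemicontinuous_cost.lowerSemicontinuousOn S).exists_isMinOn
    hne hcomp
  refine ⟨γ.1, hγ, le_antisymm (le_iInf₂ fun γ' hγ' => ?_) (iInf₂_le γ.1 hγ)⟩
  have := isProbabilityMeasure_of_mem_plans hγ'
  exact hmin (show (⟨γ', this⟩ : ProbabilityMeasure _) ∈ S from hγ')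

end Existence

/-! ### Integrated monotonicity of the barycentric projection -/

section Monotone

variable {μ ν : WSpace D} {b : Euc D → Euc D}

/-- `b` is cyclically monotone in the integrated sense: no plan that transports `μ` to itself
improves the correlation with `b`. -/
def PlanMonotone (μ : WSpace D) (b : Euc D → Euc D) : Prop :=
  ∀ σ ∈ plans μ μ, ∫ p, inner ℝ (b p.1) (p.2 - p.1) ∂σ ≤ 0

theorem memLp_comp_fst_of_mem_plans {σ : Measure (Euc D × Euc D)} (hb : MemLp b 2 μ.1)
    (hσ : σ ∈ plans μ ν) : MemLp (fun p => b p.1) 2 σ := by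
  rw [← hσ.1] at hb
  exact (memLp_map_measure_iff hb.1 measurable_fst.aemeasurable).1 hb

/-- Pointwise `2⟨x, y - x⟩ = |y|² - |x|² - |x - y|²`, and the first two terms cancel because the
marginals agree. -/
theorem two_mul_integral_inner_fst_sub {σ : Measure (Euc D × Euc D)} (hσ : σ ∈ plans μ μ) :
    2 * ∫ p, inner ℝ p.1 (p.2 - p.1) ∂σ = -∫ p, ‖p.1 - p.2‖ ^ 2 ∂σ := by
  have l1 := memLp_fst_of_mem_plans hσ
  have l2 := memLp_snd_of_mem_plans hσ
  have e1 : ∫ p, ‖p.1‖ ^ 2 ∂σ = ∫ x, ‖x‖ ^ 2 ∂μ.1 := by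
    rw [← hσ.1, integral_map measurable_fst.aemeasurable (by fun_prop)]
  have e2 : ∫ p, ‖p.2‖ ^ 2 ∂σ = ∫ x, ‖x‖ ^ 2 ∂μ.1 := by
    conv_rhs => rw [← hσ.2]
    rw [integral_map measurable_snd.aemeasurable (by fun_prop)]
  have i1 : Integrable (fun p : Euc D × Euc D => ‖p.1‖ ^ 2) σ :=
    (memLp_two_iff_integrable_sq_norm l1.1).1 l1
  have i2 : Integrable (fun p : Euc D × Euc D => ‖p.2‖ ^ 2) σ :=
    (memLp_two_iff_integrable_sq_norm l2.1).1 l2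
  have i3 : Integrable (fun p : Euc D × Euc D => ‖p.1 - p.2‖ ^ 2) σ :=
    (memLp_two_iff_integrable_sq_norm (l1.sub l2).1).1 (l1.sub l2)
  have i4 : Integrable (fun p : Euc D × Euc D => ‖p.2‖ ^ 2 - ‖p.1‖ ^ 2) σ := i2.sub i1
  have : ∫ p, (‖p.2‖ ^ 2 - ‖p.1‖ ^ 2) - ‖p.1 - p.2‖ ^ 2 ∂σ = -∫ p, ‖p.1 - p.2‖ ^ 2 ∂σ := by
    rw [integral_sub i4 i3, integral_sub i2 i1, e1, e2]; ring
  rw [← this, ← integral_const_mul]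
  refine integral_congr_ae (Eventually.of_forall fun p => ?_)
  dsimp only
  rw [norm_sub_sq_real, inner_sub_right, real_inner_self_eq_norm_sq]
  ring

theorem planMonotone_id (μ : WSpace D) : PlanMonotone μ id := fun σ hσ => by
  have h1 := two_mul_integral_inner_fst_sub hσ
  have h2 : 0 ≤ ∫ p, ‖p.1 - p.2‖ ^ 2 ∂σ := integral_nonneg fun p => by positivity
  simp only [id]
  linarith

/-- Take `ρ = μ` in `W2_sq_le_of_plans`: the zeroth-order terms cancel by optimality, and the
quadratic term cancels against the identity's share of the linear term. -/
theorem planMonotone_bary {γ : Measure (Euc D × Euc D)} [IsFiniteMeasure γ]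
    (hγ : γ ∈ optimalPlans μ ν) : PlanMonotone μ (bary γ) := fun σ hσ => by
  have h1 := two_mul_integral_inner_fst_sub hσ
  have h2 := W2_sq_le_of_plans hγ.1 hσ
  rw [W2_sq_eq hγ] at h2
  have l : MemLp (fun p : Euc D × Euc D => p.2 - p.1) 2 σ :=
    (memLp_snd_of_mem_plans hσ).sub (memLp_fst_of_mem_plans hσ)
  have h3 : ∫ p, inner ℝ (p.1 - bary γ p.1) (p.2 - p.1) ∂σ =
      (∫ p, inner ℝ p.1 (p.2 - p.1) ∂σ) - ∫ p, inner ℝ (bary γ p.1) (p.2 - p.1) ∂σ := by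
    rw [← integral_sub (integrable_inner_of_memLp (memLp_fst_of_mem_plans hσ) l)
      (integrable_inner_of_memLp (memLp_comp_fst_of_mem_plans
        (memLp_bary_of_mem_plans hγ.1) hσ) l)]
    simp only [inner_sub_left]
  linarith

/-- The mass missing from a multiple of `μ` is added on the diagonal, where the integrand vanishes;
rescaling then gives a plan from `μ` to itself. -/
theorem PlanMonotone.integral_nonpos_of_map_le (hb : MemLp b 2 μ.1) (h : PlanMonotone μ b)
    {σ : Measure (Euc D × Euc D)} [IsFiniteMeasure σ] (heq : σ.map Prod.fst = σ.map Prod.snd)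
    {C : ℝ≥0∞} (hC : C ≠ ∞) (hle : σ.map Prod.fst ≤ C • μ.1) :
    Integrable (fun p => inner ℝ (b p.1) (p.2 - p.1)) σ ∧
      ∫ p, inner ℝ (b p.1) (p.2 - p.1) ∂σ ≤ 0 := by
  -- Adding one keeps the constant invertible when `C = 0`.
  set C' := C + 1 with hC'
  have hC'top : C' ≠ ∞ := by simp [hC', hC]
  have hC'0 : C' ≠ 0 := by simp [hC']
  set p := σ.map Prod.fst with hp
  have hle' : p ≤ C' • μ.1 := hle.trans (by
    rw [hC', add_smul]; exact Measure.le_add_right le_rfl)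
  set q := C' • μ.1 - p with hq
  have hqp : q + p = C' • μ.1 := Measure.sub_add_cancel_of_le hle'
  have hdiag : Measurable fun x : Euc D => (x, x) := by fun_prop
  set σ' := C'⁻¹ • (σ + q.map fun x => (x, x)) with hσ'
  have hinv : C'⁻¹ • (C' • μ.1) = μ.1 := by
    rw [smul_smul, ENNReal.inv_mul_cancel hC'0 hC'top, one_smul]
  have hmem : σ' ∈ plans μ μ := by
    constructor
    · rw [hσ', Measure.map_smul, Measure.map_add _ _ measurable_fst,
        Measure.map_map measurable_fst hdiag, ← hp]
      have : (Prod.fst ∘ fun x : Euc D => (x, x)) = id := rfl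
      rw [this, Measure.map_id, add_comm, hqp, hinv]
    · rw [hσ', Measure.map_smul, Measure.map_add _ _ measurable_snd,
        Measure.map_map measurable_snd hdiag, ← heq]
      have : (Prod.snd ∘ fun x : Euc D => (x, x)) = id := rfl
      rw [this, Measure.map_id, add_comm, hqp, hinv]
  have hint : Integrable (fun p : Euc D × Euc D => inner ℝ (b p.1) (p.2 - p.1)) σ' :=
    integrable_inner_of_memLp (memLp_comp_fst_of_mem_plans hb hmem)
      ((memLp_snd_of_mem_plans hmem).sub (memLp_fst_of_mem_plans hmem))
  have hint2 : Integrable (fun p : Euc D × Euc D => inner ℝ (b p.1) (p.2 - p.1))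
      (σ + q.map fun x => (x, x)) :=
    (integrable_smul_measure (ENNReal.inv_ne_zero.2 hC'top) (ENNReal.inv_ne_top.2 hC'0)).1 hint
  refine ⟨hint2.left_of_add_measure, ?_⟩
  have := h σ' hmem
  rw [hσ', integral_smul_measure, integral_add_measure hint2.left_of_add_measure
    hint2.right_of_add_measure, integral_map hdiag.aemeasurable hint2.right_of_add_measure.1]
    at this
  simp only [sub_self, inner_zero_right, integral_zero, add_zero, smul_eq_mul] at this
  have hpos : 0 < (C'⁻¹).toReal :=
    ENNReal.toReal_pos (ENNReal.inv_ne_zero.2 hC'top) (ENNReal.inv_ne_top.2 hC'0)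
  exact nonpos_of_mul_nonpos_right this hpos

end Monotone

/-! ### Cyclical monotonicity and Rockafellar's potential -/

section Cyclic

variable {E : Type*} [NormedAddCommGroup E] [InnerProductSpace ℝ E]

/-- The value at `x` of the affine function obtained by following the chain `p 0, …, p n`. -/
def chainValue (n : ℕ) (p : ℕ → E × E) (x : E) : ℝ :=
  (∑ i ∈ Finset.range n, inner ℝ (p i).2 ((p (i + 1)).1 - (p i).1)) +
    inner ℝ (p n).2 (x - (p n).1)

/-- Cyclical monotonicity of a set of pairs. -/
def CyclicallyMonotone (Γ : Set (E × E)) : Prop :=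
  ∀ (n : ℕ) (p : ℕ → E × E), (∀ i, p i ∈ Γ) → chainValue n p (p 0).1 ≤ 0

/-- Only the entries `0, …, n` of the sequence matter, so a chain is prolonged by overwriting entry
`n + 1`. -/
theorem chainValue_succ_update (n : ℕ) (p : ℕ → E × E) (q : E × E) (x : E) :
    chainValue (n + 1) (Function.update p (n + 1) q) x =
      chainValue n p q.1 + inner ℝ q.2 (x - q.1) := by
  simp only [chainValue, Finset.sum_range_succ, Function.update_self]
  congr 2
  · refine Finset.sum_congr rfl fun i hi => ?_
    have := Finset.mem_range.1 hi
    rw [Function.update_of_ne (by omega), Function.update_of_ne (by omega)]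
  · rw [Function.update_of_ne (by omega)]

/-- Rockafellar's potential of a cyclically monotone set. -/
theorem CyclicallyMonotone.exists_potential [MeasurableSpace E] [BorelSpace E] {Γ : Set (E × E)}
    (hΓ : CyclicallyMonotone Γ) :
    ∃ f : E → ℝ, Measurable f ∧
      ∀ q ∈ Γ, ∀ r ∈ Γ, inner ℝ q.2 (r.1 - q.1) ≤ f r.1 - f q.1 := by
  rcases Γ.eq_empty_or_nonempty with rfl | ⟨q₀, hq₀⟩
  · exact ⟨0, measurable_const, by simp⟩
  let I := ℕ × {p : ℕ → E × E // (∀ i, p i ∈ Γ) ∧ p 0 = q₀}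
  let U : E → EReal := fun x => ⨆ i : I, ((chainValue i.1 i.2.1 x : ℝ) : EReal)
  have hU : LowerSemicontinuous U := lowerSemicontinuous_iSup fun i => by
    refine Continuous.lowerSemicontinuous (continuous_coe_real_ereal.comp ?_)
    unfold chainValue
    fun_prop
  have hupd : ∀ (i : I) (q : E × E), q ∈ Γ →
      (∀ j, Function.update i.2.1 (i.1 + 1) q j ∈ Γ) ∧
        Function.update i.2.1 (i.1 + 1) q 0 = q₀ := fun i q hq => by
    refine ⟨fun j => ?_, ?_⟩
    · rcases eq_or_ne j (i.1 + 1) with rfl | hj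
      · rwa [Function.update_self]
      · rw [Function.update_of_ne hj]; exact i.2.2.1 j
    · rw [Function.update_of_ne (by omega)]; exact i.2.2.2
  -- Prolonging a chain by `q` and closing it at `q₀` bounds `U` above; the one-point chain bounds
  -- it below.
  have hfin : ∀ q ∈ Γ, ∃ a : ℝ, U q.1 = a := fun q hq => by
    have hle : U q.1 ≤ ((-inner ℝ q.2 (q₀.1 - q.1) : ℝ) : EReal) := iSup_le fun i => by
      have h1 := hΓ (i.1 + 1) _ (hupd i q hq).1
      rw [(hupd i q hq).2, chainValue_succ_update] at h1
      exact EReal.coe_le_coe_iff.2 (by linarith)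
    have hge : ((chainValue 0 (fun _ => q₀) q.1 : ℝ) : EReal) ≤ U q.1 :=
      le_iSup (fun i : I => ((chainValue i.1 i.2.1 q.1 : ℝ) : EReal))
        ⟨0, fun _ => q₀, fun _ => hq₀, rfl⟩
    exact ⟨_, (EReal.coe_toReal (hle.trans_lt (EReal.coe_lt_top _)).ne
      ((EReal.bot_lt_coe _).trans_le hge).ne').symm⟩
  -- Away from the first components of `Γ`, `U` may be infinite; the value given by `toReal` there
  -- plays no role.
  refine ⟨fun x => (U x).toReal, hU.measurable.ereal_toReal, fun q hq r hr => ?_⟩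
  obtain ⟨a, ha⟩ := hfin q hq
  obtain ⟨c, hc⟩ := hfin r hr
  have hac : U q.1 ≤ ((c - inner ℝ q.2 (r.1 - q.1) : ℝ) : EReal) := iSup_le fun i => by
    have h1 : ((chainValue (i.1 + 1) (Function.update i.2.1 (i.1 + 1) q) r.1 : ℝ) : EReal)
        ≤ U r.1 :=
      le_iSup (fun i : I => ((chainValue i.1 i.2.1 r.1 : ℝ) : EReal)) ⟨i.1 + 1, _, hupd i q hq⟩
    rw [chainValue_succ_update, hc, EReal.coe_le_coe_iff] at h1
    exact EReal.coe_le_coe_iff.2 (by linarith)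
  rw [ha, EReal.coe_le_coe_iff] at hac
  simp only [ha, hc, EReal.toReal_coe]
  linarith

theorem eventually_forall_ball_lt_inner (q r : E × E) {ε : ℝ} (hε : 0 < ε) :
    ∀ᶠ δ in 𝓝[>] (0 : ℝ), ∀ q' ∈ Metric.ball q δ, ∀ r' ∈ Metric.ball r δ,
      inner ℝ q.2 (r.1 - q.1) - ε < inner ℝ q'.2 (r'.1 - q'.1) := by
  have hc : Continuous fun s : (E × E) × (E × E) => (inner ℝ s.1.2 (s.2.1 - s.1.1) : ℝ) := by
    fun_prop
  have := (hc.tendsto (q, r)).eventually (eventually_gt_nhds (sub_lt_self _ hε))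
  obtain ⟨δ₀, hδ₀, h⟩ := Metric.eventually_nhds_iff_ball.1 this
  filter_upwards [Ioo_mem_nhdsGT hδ₀] with δ hδ q' hq' r' hr'
  refine h (q', r') ?_
  rw [← ball_prod_same]
  exact ⟨Metric.ball_subset_ball hδ.2.le hq', Metric.ball_subset_ball hδ.2.le hr'⟩

end Cyclic

/-! ### From integrated to pointwise cyclical monotonicity -/

section CyclicMeasure

variable {μ : WSpace D} {b : Euc D → Euc D}

/-- A cycle in the support with positive value persists on small balls around its points. These have
positive mass, so moving mass cyclically between them contradicts `PlanMonotone`. -/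
theorem PlanMonotone.cyclicallyMonotone (hm : Measurable b) (hb : MemLp b 2 μ.1)
    (h : PlanMonotone μ b) : CyclicallyMonotone (μ.1.map fun x => (x, b x)).support := by
  intro n p hp
  by_contra hcon
  push Not at hcon
  set v : ℕ → ℝ := fun i => inner ℝ (p i).2 ((p (i + 1)).1 - (p i).1) with hv
  set v' : ℝ := inner ℝ (p n).2 ((p 0).1 - (p n).1) with hv'
  have hS : 0 < (∑ i ∈ Finset.range n, v i) + v' := hcon
  set S := (∑ i ∈ Finset.range n, v i) + v' with hSdef
  -- Each of the `n + 1` links may lose `ε`, which leaves `S / 2`.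
  set ε : ℝ := S / (2 * (n + 1)) with hεdef
  have hε : 0 < ε := by positivity
  have hev : ∀ᶠ δ in 𝓝[>] (0 : ℝ),
      (∀ i ∈ Finset.range n, ∀ q' ∈ Metric.ball (p i) δ, ∀ r' ∈ Metric.ball (p (i + 1)) δ,
        v i - ε < inner ℝ q'.2 (r'.1 - q'.1)) ∧
      ∀ q' ∈ Metric.ball (p n) δ, ∀ r' ∈ Metric.ball (p 0) δ,
        v' - ε < inner ℝ q'.2 (r'.1 - q'.1) :=
    ((Finset.range n).eventually_all.2 fun i _ =>
      eventually_forall_ball_lt_inner (p i) (p (i + 1)) hε).and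
      (eventually_forall_ball_lt_inner (p n) (p 0) hε)
  obtain ⟨δ, ⟨h1, h2⟩, hδ⟩ := (hev.and self_mem_nhdsWithin).exists
  have hg : Measurable fun x => (x, b x) := by fun_prop
  set V : ℕ → Set (Euc D) := fun i => (fun x => (x, b x)) ⁻¹' Metric.ball (p i) δ with hV
  have hVm : ∀ i, MeasurableSet (V i) := fun i => hg measurableSet_ball
  have hV0 : ∀ i, μ.1 (V i) ≠ 0 := fun i => by
    have := (Measure.mem_support_iff_forall (p i)).1 (hp i) _ (Metric.ball_mem_nhds _ hδ)
    rw [Measure.map_apply hg measurableSet_ball] at this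
    exact this.ne'
  set κ : ℕ → Measure (Euc D) := fun i => ProbabilityTheory.cond μ.1 (V i) with hκ
  have hκp : ∀ i, IsProbabilityMeasure (κ i) := fun i => cond_isProbabilityMeasure (hV0 i)
  have hκle : ∀ i, κ i ≤ (μ.1 (V i))⁻¹ • μ.1 := fun i => by
    simp only [hκ, ProbabilityTheory.cond]
    refine Measure.le_iff'.2 fun s => ?_
    simp only [Measure.smul_apply, smul_eq_mul]
    gcongr
    exact Measure.restrict_le_self
  have hκV : ∀ i, ∀ᵐ x ∂κ i, x ∈ V i := fun i => ae_cond_mem (hVm i)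
  -- Each `κ i` occurs once as a source and once as a target, so the marginals agree.
  set σ : Measure (Euc D × Euc D) :=
    (∑ i ∈ Finset.range n, (κ i).prod (κ (i + 1))) + (κ n).prod (κ 0) with hσ
  have hfst : σ.map Prod.fst = ∑ i ∈ Finset.range (n + 1), κ i := by
    rw [Finset.sum_range_succ, hσ, Measure.map_add _ _ measurable_fst, Measure.map_fst_prod,
      ← Measure.mapₗ_apply_of_measurable measurable_fst, map_sum]
    simp [Measure.mapₗ_apply_of_measurable measurable_fst, Measure.map_fst_prod]
  have hsnd : σ.map Prod.snd = ∑ i ∈ Finset.range (n + 1), κ i := by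
    rw [Finset.sum_range_succ', hσ, Measure.map_add _ _ measurable_snd, Measure.map_snd_prod,
      ← Measure.mapₗ_apply_of_measurable measurable_snd, map_sum]
    simp [Measure.mapₗ_apply_of_measurable measurable_snd, Measure.map_snd_prod]
  have hle : σ.map Prod.fst ≤ (∑ i ∈ Finset.range (n + 1), (μ.1 (V i))⁻¹) • μ.1 := by
    rw [hfst, Finset.sum_smul]
    exact Finset.sum_le_sum fun i _ => hκle i
  have hCtop : ∑ i ∈ Finset.range (n + 1), (μ.1 (V i))⁻¹ ≠ ∞ :=
    ENNReal.sum_ne_top.2 fun i _ => ENNReal.inv_ne_top.2 (hV0 i)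
  obtain ⟨hint, hneg⟩ := h.integral_nonpos_of_map_le hb (hfst.trans hsnd.symm) hCtop hle
  have hprod : ∀ (i j : ℕ) (c : ℝ),
      (∀ q' ∈ Metric.ball (p i) δ, ∀ r' ∈ Metric.ball (p j) δ,
        c < inner ℝ q'.2 (r'.1 - q'.1)) →
      Integrable (fun p : Euc D × Euc D => inner ℝ (b p.1) (p.2 - p.1)) ((κ i).prod (κ j)) →
      c ≤ ∫ p, inner ℝ (b p.1) (p.2 - p.1) ∂(κ i).prod (κ j) := fun i j c hc hi => by
    have e : ∫ _, c ∂(κ i).prod (κ j) = c := by simp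
    rw [← e]
    refine integral_mono_ae (integrable_const _) hi ?_
    have hx : ∀ᵐ q ∂(κ i).prod (κ j), q.1 ∈ V i := Measure.quasiMeasurePreserving_fst.ae (hκV i)
    have hy : ∀ᵐ q ∂(κ i).prod (κ j), q.2 ∈ V j := Measure.quasiMeasurePreserving_snd.ae (hκV j)
    filter_upwards [hx, hy] with q hqx hqy
    exact (hc (q.1, b q.1) hqx (q.2, b q.2) hqy).le
  have hint1 := hint.left_of_add_measure
  have hint2 := hint.right_of_add_measure
  rw [hσ, integral_add_measure hint1 hint2, integral_finsetSum_measure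
    (integrable_finsetSum_measure.1 hint1)] at hneg
  have hlow : ∑ i ∈ Finset.range n, (v i - ε) ≤
      ∑ i ∈ Finset.range n, ∫ p, inner ℝ (b p.1) (p.2 - p.1) ∂(κ i).prod (κ (i + 1)) :=
    Finset.sum_le_sum fun i hi => hprod i (i + 1) _ (h1 i hi)
      (integrable_finsetSum_measure.1 hint1 i hi)
  have hlow' := hprod n 0 _ h2 hint2
  rw [Finset.sum_sub_distrib, Finset.sum_const, Finset.card_range, nsmul_eq_mul] at hlow
  have : ε * (2 * (n + 1)) = S := by rw [hεdef]; field_simp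
  nlinarith

theorem ae_mem_support_graph (hm : Measurable b) :
    ∀ᵐ x ∂μ.1, (x, b x) ∈ (μ.1.map fun x => (x, b x)).support := by
  have hg : Measurable fun x => (x, b x) := by fun_prop
  exact ae_of_ae_map hg.aemeasurable Measure.support_mem_ae

end CyclicMeasure

/-! ### Monotonicity for absolutely continuous marginals -/

section Potential

variable {E : Type*} [NormedAddCommGroup E] [InnerProductSpace ℝ E] [MeasurableSpace E]

/-- A field with a measurable potential does not correlate with the displacement of a measure
that has equal marginals, even if the potential is not integrable. -/
theorem integral_inner_nonpos_of_potential {b : E → E} {f : E → ℝ} (hf : Measurable f)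
    {σ : Measure (E × E)} [IsFiniteMeasure σ] (heq : σ.map Prod.fst = σ.map Prod.snd)
    (hint : Integrable (fun p => inner ℝ (b p.1) (p.2 - p.1)) σ)
    (h : ∀ᵐ p ∂σ, inner ℝ (b p.1) (p.2 - p.1) ≤ f p.2 - f p.1) :
    ∫ p, inner ℝ (b p.1) (p.2 - p.1) ∂σ ≤ 0 := by
  set k : E × E → ℝ := fun p => inner ℝ (b p.1) (p.2 - p.1) with hk
  -- The potential need not be integrable; its truncations are, and their differences integrate to
  -- zero by equality of the marginals.
  set c : ℕ → ℝ → ℝ := fun N t => max (-N) (min t N) with hc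
  have hcm : ∀ N, Measurable (c N) := fun N => by fun_prop
  have hcb : ∀ N t, |c N t| ≤ N := fun N t => by
    have : (0 : ℝ) ≤ N := N.cast_nonneg
    rw [abs_le]
    exact ⟨le_max_left _ _, max_le (by linarith) (min_le_right _ _)⟩
  have hi1 : ∀ N, Integrable (fun p : E × E => c N (f p.1)) σ := fun N =>
    Integrable.of_bound ((hcm N).comp (hf.comp measurable_fst)).aestronglyMeasurable N
      (Eventually.of_forall fun p => hcb N _)
  have hi2 : ∀ N, Integrable (fun p : E × E => c N (f p.2)) σ := fun N =>
    Integrable.of_bound ((hcm N).comp (hf.comp measurable_snd)).aestronglyMeasurable N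
      (Eventually.of_forall fun p => hcb N _)
  have hzero : ∀ N, ∫ p, (c N (f p.2) - c N (f p.1)) ∂σ = 0 := fun N => by
    rw [integral_sub (hi2 N) (hi1 N), sub_eq_zero]
    have h1 := integral_map (μ := σ) measurable_snd.aemeasurable (f := fun x => c N (f x))
      ((hcm N).comp hf).aestronglyMeasurable
    have h2 := integral_map (μ := σ) measurable_fst.aemeasurable (f := fun x => c N (f x))
      ((hcm N).comp hf).aestronglyMeasurable
    rw [← h1, ← h2, heq]
  -- Truncation is monotone and 1-Lipschitz, so `f p.2 - f p.1 ≥ -|k p|` survives it. The minimum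
  -- supplies the upper bound, so `|k|` dominates, and the limit integrand is still at least `k`.
  have htend : Tendsto (fun N => ∫ p, min (c N (f p.2) - c N (f p.1)) |k p| ∂σ) atTop
      (𝓝 (∫ p, min (f p.2 - f p.1) |k p| ∂σ)) := by
    refine tendsto_integral_of_dominated_convergence (fun p => |k p|) (fun N => ?_) hint.abs
      (fun N => ?_) (Eventually.of_forall fun p => ?_)
    · exact (((hi2 N).sub (hi1 N)).inf hint.abs).1
    · filter_upwards [h] with p hp
      have h1 : -|k p| ≤ c N (f p.2) - c N (f p.1) := by
        have h0 : f p.1 - |k p| ≤ f p.2 := by have := neg_abs_le (k p); linarith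
        have ha : 0 ≤ |k p| := abs_nonneg _
        have h2 : min (f p.1) N - |k p| ≤ min (f p.2) N :=
          le_min (by linarith [min_le_left (f p.1) (N : ℝ)])
            (by linarith [min_le_right (f p.1) (N : ℝ)])
        have h3 : c N (f p.1) ≤ c N (f p.2) + |k p| :=
          max_le (by linarith [le_max_left (-(N : ℝ)) (min (f p.2) N)])
            (by linarith [le_max_right (-(N : ℝ)) (min (f p.2) N)])
        linarith
      rw [Real.norm_eq_abs, abs_le]
      exact ⟨le_min h1 (by linarith [abs_nonneg (k p)]), min_le_right _ _⟩
    · have hconv : ∀ t, Tendsto (fun N => c N t) atTop (𝓝 t) := fun t => by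
        refine tendsto_const_nhds.congr' ?_
        filter_upwards [eventually_ge_atTop ⌈|t|⌉₊] with N hN
        have : |t| ≤ N := (Nat.le_ceil _).trans (by exact_mod_cast hN)
        rw [abs_le] at this
        simp only [hc, min_eq_left this.2, max_eq_right this.1]
      exact ((hconv _).sub (hconv _)).min tendsto_const_nhds
  have hle : ∫ p, min (f p.2 - f p.1) |k p| ∂σ ≤ 0 := by
    refine le_of_tendsto' htend fun N => ?_
    rw [← hzero N]
    exact integral_mono (((hi2 N).sub (hi1 N)).inf hint.abs) ((hi2 N).sub (hi1 N))
      fun p => min_le_left _ _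
  refine le_trans (integral_mono_ae hint ?_ ?_) hle
  · refine hint.abs.mono' ?_ ?_
    · exact (((hf.comp measurable_snd).sub (hf.comp measurable_fst)).aestronglyMeasurable).inf
        hint.abs.1
    · filter_upwards [h] with p hp
      rw [Real.norm_eq_abs, abs_le]
      exact ⟨le_min (by have := neg_abs_le (k p); linarith)
        (by linarith [abs_nonneg (k p)]), min_le_right _ _⟩
  · filter_upwards [h] with p hp
    exact le_min hp (le_abs_self _)

theorem PlanMonotone.integral_nonpos {μ : WSpace D} {b : Euc D → Euc D} (hm : Measurable b)
    (hb : MemLp b 2 μ.1) (h : PlanMonotone μ b) {σ : Measure (Euc D × Euc D)} [IsFiniteMeasure σ]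
    (heq : σ.map Prod.fst = σ.map Prod.snd) (hac : σ.map Prod.fst ≪ μ.1)
    (hint : Integrable (fun p => inner ℝ (b p.1) (p.2 - p.1)) σ) :
    ∫ p, inner ℝ (b p.1) (p.2 - p.1) ∂σ ≤ 0 := by
  obtain ⟨f, hf, hfb⟩ := (h.cyclicallyMonotone hm hb).exists_potential
  refine integral_inner_nonpos_of_potential hf heq hint ?_
  have h1 := hac.ae_le (ae_mem_support_graph (μ := μ) hm)
  have h2 := h1
  rw [heq] at h2
  filter_upwards [ae_of_ae_map measurable_fst.aemeasurable h1,
    ae_of_ae_map measurable_snd.aemeasurable h2] with p hp1 hp2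
  exact hfb _ hp1 _ hp2

end Potential

/-! ### Smooth profiles and mollification -/

section Bump

variable {E : Type*} [NormedAddCommGroup E] [InnerProductSpace ℝ E] [FiniteDimensional ℝ E]
  [MeasurableSpace E] [BorelSpace E]

/-- A smooth nonnegative profile supported in the unit ball with slope at most one. -/
structure IsProfile (κ : E → ℝ) : Prop where
  contDiff : ContDiff ℝ ((⊤ : ℕ∞) : WithTop ℕ∞) κ
  hasCompactSupport : HasCompactSupport κ
  fderiv_eq_zero : ∀ a, a ∉ Metric.closedBall (0 : E) 1 → fderiv ℝ κ a = 0
  norm_fderiv_le : ∀ a, ‖fderiv ℝ κ a‖ ≤ 1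
  integral_pos : 0 < ∫ a, κ a

variable (E) in
-- A smooth bump divided by `C + 1`, where `C` bounds its derivative.
theorem exists_isProfile : ∃ κ : E → ℝ, IsProfile κ := by
  let f : ContDiffBump (0 : E) := ⟨1 / 2, 1, by norm_num, by norm_num⟩
  have hf : ContDiff ℝ ((⊤ : ℕ∞) : WithTop ℕ∞) f := f.contDiff
  have hd : Continuous (fderiv ℝ f) := hf.continuous_fderiv (by simp)
  obtain ⟨C, hC⟩ := (f.hasCompactSupport.fderiv (𝕜 := ℝ)).exists_bound_of_continuous hd
  have hC0 : 0 ≤ C := (norm_nonneg _).trans (hC 0)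
  have hfd : ∀ a, fderiv ℝ (fun x => (C + 1)⁻¹ * f x) a = (C + 1)⁻¹ • fderiv ℝ f a := fun a =>
    fderiv_const_mul (hf.differentiable (by simp) a) _
  refine ⟨fun x => (C + 1)⁻¹ * f x, contDiff_const.mul hf, f.hasCompactSupport.mul_left,
    fun a ha => ?_, fun a => ?_, ?_⟩
  · rw [hfd, fderiv_of_notMem_tsupport (𝕜 := ℝ) (f := f) (by rwa [f.tsupport_eq]), smul_zero]
  · rw [hfd, norm_smul, Real.norm_of_nonneg (by positivity), inv_mul_le_iff₀ (by positivity)]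
    linarith [hC a]
  · rw [integral_const_mul]
    exact mul_pos (by positivity) f.integral_pos

/-- The uniform measure on the unit ball. -/
abbrev ballMeasure (E : Type*) [NormedAddCommGroup E] [InnerProductSpace ℝ E]
    [FiniteDimensional ℝ E] [MeasurableSpace E] [BorelSpace E] : Measure E :=
  volume.restrict (Metric.closedBall (0 : E) 1)

instance : IsFiniteMeasure (ballMeasure E) :=
  ⟨by rw [Measure.restrict_apply_univ]; exact measure_closedBall_lt_top⟩

theorem integral_inner_ballMeasure (p : E) : ∫ a, inner ℝ p a ∂ballMeasure E = 0 := by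
  rw [← integral_indicator Metric.isClosed_closedBall.measurableSet]
  set g := (Metric.closedBall (0 : E) 1).indicator fun a => (inner ℝ p a : ℝ) with hg
  have h1 : ∫ a, g (-a) = ∫ a, g a := integral_neg_eq_self g volume
  have h2 : ∀ a, g (-a) = -g a := fun a => by
    simp only [hg, Set.indicator, mem_closedBall_zero_iff, norm_neg, inner_neg_right]
    split_ifs <;> simp
  simp only [h2, integral_neg] at h1
  linarith

variable {κ : E → ℝ}

theorem IsProfile.continuous_fderiv (hκ : IsProfile κ) : Continuous (fderiv ℝ κ) :=
  hκ.contDiff.continuous_fderiv (by simp)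

theorem IsProfile.integral_ballMeasure (hκ : IsProfile κ) (f : E → ℝ) (v : E) :
    ∫ a, f a * fderiv ℝ κ a v ∂ballMeasure E = ∫ a, f a * fderiv ℝ κ a v :=
  setIntegral_eq_integral_of_forall_compl_eq_zero fun a ha => by
    rw [hκ.fderiv_eq_zero a ha]; simp

theorem IsProfile.integrable (hκ : IsProfile κ) {f : E → ℝ} (hf : Continuous f) (v : E) :
    Integrable (fun a => f a * fderiv ℝ κ a v) :=
  (hf.mul (hκ.continuous_fderiv.clm_apply continuous_const)).integrable_of_hasCompactSupport
    ((hκ.hasCompactSupport.fderiv_apply (𝕜 := ℝ) v).mul_left)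

theorem IsProfile.integral_mul_fderiv (hκ : IsProfile κ) {f : E → ℝ}
    (hf : ContDiff ℝ 1 f) (v : E) :
    ∫ a, f a * fderiv ℝ κ a v ∂ballMeasure E = -∫ a, fderiv ℝ f a v * κ a := by
  rw [hκ.integral_ballMeasure]
  have hκc := hκ.contDiff.continuous
  refine integral_mul_fderiv_eq_neg_fderiv_mul_of_integrable ?_ (hκ.integrable hf.continuous v) ?_
    (fun x _ => hf.differentiable (by simp) x) (fun x _ => hκ.contDiff.differentiable (by simp) x)
  · exact (((hf.continuous_fderiv (by simp)).clm_apply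
      continuous_const).mul hκc).integrable_of_hasCompactSupport hκ.hasCompactSupport.mul_left
  · exact (hf.continuous.mul hκc).integrable_of_hasCompactSupport hκ.hasCompactSupport.mul_left

theorem IsProfile.integral_fderiv (hκ : IsProfile κ) (v : E) :
    ∫ a, fderiv ℝ κ a v ∂ballMeasure E = 0 := by
  have := hκ.integral_mul_fderiv (contDiff_const (c := (1 : ℝ))) v
  simpa using this

/-- Integration by parts: tilting the uniform law by `⟨∇κ, v⟩` shifts its first moment by `-v ∫ κ`.
-/
theorem IsProfile.integral_inner_mul_fderiv (hκ : IsProfile κ) (p v : E) :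
    ∫ a, inner ℝ p a * fderiv ℝ κ a v ∂ballMeasure E = -(inner ℝ p v * ∫ a, κ a) := by
  have := hκ.integral_mul_fderiv (f := fun a => inner ℝ p a) (innerSL ℝ p).contDiff v
  rw [this, ← integral_const_mul]
  congr 2
  ext a
  have : fderiv ℝ (fun a => inner ℝ p a) a = innerSL ℝ p := (innerSL ℝ p).fderiv
  rw [this]
  rfl

/-- `G` is the convolution of `F` with `κ`, with the derivative falling on `κ`. -/
theorem IsProfile.exists_fderiv_eq_integral_one (hκ : IsProfile κ) {F : E → ℝ}
    (hF : Continuous F) (hFc : HasCompactSupport F) :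
    ∃ G : E → ℝ, ContDiff ℝ ((⊤ : ℕ∞) : WithTop ℕ∞) G ∧ HasCompactSupport G ∧
      ∀ z v, fderiv ℝ G z v = ∫ a, F (z - a) * fderiv ℝ κ a v ∂ballMeasure E := by
  have hFi : LocallyIntegrable F (volume : Measure E) := hF.locallyIntegrable
  obtain ⟨L, hL⟩ : ∃ L : ℝ →L[ℝ] ℝ →L[ℝ] ℝ, ∀ x y, L x y = x * y :=
    ⟨ContinuousLinearMap.mul ℝ ℝ, fun _ _ => rfl⟩
  have h1 : ContDiff ℝ ((⊤ : ℕ∞) : WithTop ℕ∞) (convolution F κ L volume) :=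
    hκ.hasCompactSupport.contDiff_convolution_right L hFi hκ.contDiff
  have h2 : HasCompactSupport (convolution F κ L volume) :=
    hFc.convolution L hκ.hasCompactSupport
  have h4 : ContDiff ℝ 1 κ := hκ.contDiff.of_le (by simp)
  have h3 : ∀ z, HasFDerivAt (convolution F κ L volume) _ z :=
    hκ.hasCompactSupport.hasFDerivAt_convolution_right L hFi h4
  refine ⟨_, h1, h2, fun z v => ?_⟩
  rw [(h3 z).fderiv]
  have h5 := convolution_precompR_apply (μ := volume) L hFi
    (hκ.hasCompactSupport.fderiv (𝕜 := ℝ)) hκ.continuous_fderiv z v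
  rw [h5, hκ.integral_ballMeasure, convolution_def, ← integral_sub_left_eq_self _ volume z]
  refine integral_congr_ae (Eventually.of_forall fun a => ?_)
  simp only [hL, sub_sub_cancel]

/-- Rescaled to blur width `h`; the prefactor `h` in `φ` cancels the `h⁻¹` of the chain rule. It
shows that the effect of the tilt on a test function of `z - h a` is a gradient paired with `w`. -/
theorem IsProfile.exists_fderiv_eq_integral (hκ : IsProfile κ) {h : ℝ} (hh : h ≠ 0) {f : E → ℝ}
    (hf : Continuous f) (hfc : HasCompactSupport f) :
    ∃ φ : E → ℝ, ContDiff ℝ ((⊤ : ℕ∞) : WithTop ℕ∞) φ ∧ HasCompactSupport φ ∧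
      ∀ z v, fderiv ℝ φ z v = ∫ a, f (z - h • a) * fderiv ℝ κ a v ∂ballMeasure E := by
  have hFc : HasCompactSupport fun u => f (h • u) :=
    hfc.comp_homeomorph (Homeomorph.smulOfNeZero h hh)
  obtain ⟨G, hG, hGc, hGd⟩ := hκ.exists_fderiv_eq_integral_one
    (hf.comp (continuous_const_smul h)) hFc
  refine ⟨fun z => h * G (h⁻¹ • z), contDiff_const.mul (hG.comp (contDiff_const_smul _)),
    (hGc.comp_homeomorph (Homeomorph.smulOfNeZero h⁻¹ (inv_ne_zero hh))).mul_left,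
    fun z v => ?_⟩
  have hd : HasFDerivAt (fun z : E => h⁻¹ • z) (h⁻¹ • ContinuousLinearMap.id ℝ E) z :=
    (hasFDerivAt_id z).const_smul h⁻¹
  have hcomp := (((hG.differentiable (by simp) (h⁻¹ • z)).hasFDerivAt).comp z hd).const_mul h
  have e : fderiv ℝ (fun z => h * G (h⁻¹ • z)) z v = fderiv ℝ G (h⁻¹ • z) v := by
    rw [HasFDerivAt.fderiv (f := fun z => h * G (h⁻¹ • z)) hcomp]
    simp [hh]
  rw [e, hGd]
  simp only [Function.comp_apply, smul_sub, smul_inv_smul₀ hh]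

end Bump

/-! ### A coupling that replaces the flow of a divergence-free field -/

section Perturbation

variable {E : Type*} [NormedAddCommGroup E] [InnerProductSpace ℝ E] [FiniteDimensional ℝ E]
  [MeasurableSpace E] [BorelSpace E]

/-- The density `1 + ⟨∇κ(a), w(z)⟩` in `(z, a)`. -/
def driftDensity (κ : E → ℝ) (w : E → E) (p : E × E) : ℝ := 1 + fderiv ℝ κ p.2 (w p.1)

/-- The law of `(z, a)` with `z` distributed by `m` and `a` drifting in the direction `-w(z)`. -/
def driftMeasure (m : Measure E) (κ : E → ℝ) (w : E → E) : Measure (E × E) :=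
  (m.prod (ballMeasure E)).withDensity fun p => ENNReal.ofReal (driftDensity κ w p)

/-- The map `(z, a) ↦ (z - h a, z)`. -/
def shiftMap (h : ℝ) (p : E × E) : E × E := (p.1 - h • p.2, p.1)

theorem measurable_shiftMap (h : ℝ) : Measurable (shiftMap (E := E) h) := by
  unfold shiftMap; fun_prop

variable {m : Measure E} {κ : E → ℝ} {w : E → E}

theorem IsProfile.abs_fderiv_apply_le (hκ : IsProfile κ) {v : E} (hv : ‖v‖ ≤ 1) (a : E) :
    |fderiv ℝ κ a v| ≤ 1 := by
  rw [← Real.norm_eq_abs]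
  refine ((fderiv ℝ κ a).le_opNorm v).trans ?_
  have := hκ.norm_fderiv_le a
  calc ‖fderiv ℝ κ a‖ * ‖v‖ ≤ 1 * 1 := by gcongr
    _ = 1 := one_mul 1

theorem IsProfile.measurable_fderiv_apply (hκ : IsProfile κ) (hw : Measurable w) :
    Measurable fun p : E × E => fderiv ℝ κ p.2 (w p.1) := by
  have hc : Continuous fun q : E × E => fderiv ℝ κ q.1 q.2 :=
    (hκ.continuous_fderiv.comp continuous_fst).clm_apply continuous_snd
  exact hc.measurable.comp (measurable_snd.prodMk (hw.comp measurable_fst))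

theorem IsProfile.measurable_driftDensity (hκ : IsProfile κ) (hw : Measurable w) :
    Measurable (driftDensity κ w) :=
  measurable_const.add (hκ.measurable_fderiv_apply hw)

theorem IsProfile.driftDensity_nonneg (hκ : IsProfile κ)
    (hw1 : ∀ z, ‖w z‖ ≤ 1) (p : E × E) : 0 ≤ driftDensity κ w p := by
  have := (abs_le.1 (hκ.abs_fderiv_apply_le (hw1 p.1) p.2)).1
  unfold driftDensity; linarith

theorem IsProfile.driftDensity_le (hκ : IsProfile κ)
    (hw1 : ∀ z, ‖w z‖ ≤ 1) (p : E × E) : driftDensity κ w p ≤ 2 := by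
  have := (abs_le.1 (hκ.abs_fderiv_apply_le (hw1 p.1) p.2)).2
  unfold driftDensity; linarith

theorem IsProfile.integrable_driftDensity [IsFiniteMeasure m]
    (hκ : IsProfile κ) (hw : Measurable w)
    (hw1 : ∀ z, ‖w z‖ ≤ 1) : Integrable (driftDensity κ w) (m.prod (ballMeasure E)) :=
  Integrable.of_bound (hκ.measurable_driftDensity hw).aestronglyMeasurable 2
    (Eventually.of_forall fun p => by
      rw [Real.norm_of_nonneg (hκ.driftDensity_nonneg hw1 p)]; exact hκ.driftDensity_le hw1 p)

theorem IsProfile.isFiniteMeasure_driftMeasure [IsFiniteMeasure m]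
    (hκ : IsProfile κ) (hw : Measurable w)
    (hw1 : ∀ z, ‖w z‖ ≤ 1) : IsFiniteMeasure (driftMeasure m κ w) :=
  isFiniteMeasure_withDensity_ofReal (hκ.integrable_driftDensity hw hw1).2

theorem IsProfile.integral_driftMeasure (hκ : IsProfile κ) (hw : Measurable w)
    (hw1 : ∀ z, ‖w z‖ ≤ 1) (F : E × E → ℝ) :
    ∫ p, F p ∂driftMeasure m κ w = ∫ p, driftDensity κ w p * F p ∂m.prod (ballMeasure E) := by
  rw [driftMeasure, integral_withDensity_eq_integral_toReal_smul
    (hκ.measurable_driftDensity hw).ennreal_ofReal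
    (Eventually.of_forall fun _ => ENNReal.ofReal_lt_top)]
  refine integral_congr_ae (Eventually.of_forall fun p => ?_)
  simp only [ENNReal.toReal_ofReal (hκ.driftDensity_nonneg hw1 p), smul_eq_mul]

/-- The drift is seen by the integrals of functions of `(z, a)` as an additional term. -/
theorem IsProfile.integral_driftMeasure_eq_add [IsFiniteMeasure m]
    (hκ : IsProfile κ) (hw : Measurable w)
    (hw1 : ∀ z, ‖w z‖ ≤ 1) {F : E × E → ℝ} (hF : Measurable F) {C : ℝ}
    (hC : ∀ᵐ p ∂m.prod (ballMeasure E), |F p| ≤ C) :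
    ∫ p, F p ∂driftMeasure m κ w = (∫ p, F p ∂m.prod (ballMeasure E)) +
      ∫ z, ∫ a, F (z, a) * fderiv ℝ κ a (w z) ∂ballMeasure E ∂m := by
  have hF1 : Integrable F (m.prod (ballMeasure E)) :=
    Integrable.of_bound hF.aestronglyMeasurable C hC
  have hF2 : Integrable (fun p : E × E => F p * fderiv ℝ κ p.2 (w p.1))
      (m.prod (ballMeasure E)) := by
    refine Integrable.of_bound (hF.mul (hκ.measurable_fderiv_apply hw)).aestronglyMeasurable C ?_
    filter_upwards [hC] with p hp
    rw [norm_mul, Real.norm_eq_abs, Real.norm_eq_abs]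
    calc |F p| * |fderiv ℝ κ p.2 (w p.1)| ≤ |F p| * 1 := by
          gcongr; exact hκ.abs_fderiv_apply_le (hw1 _) _
      _ ≤ C := by rwa [mul_one]
  rw [hκ.integral_driftMeasure hw hw1, ← integral_prod _ hF2, ← integral_add hF1 hF2]
  refine integral_congr_ae (Eventually.of_forall fun p => ?_)
  simp only [driftDensity]
  ring

/-- For fixed `z` the tilt integrates to zero in `a`, so the law of `z` keeps the weight it has
without drift. -/
theorem IsProfile.map_fst_driftMeasure [IsFiniteMeasure m]
    (hκ : IsProfile κ) (hw : Measurable w)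
    (hw1 : ∀ z, ‖w z‖ ≤ 1) :
    (driftMeasure m κ w).map Prod.fst = ballMeasure E Set.univ • m := by
  refine Measure.ext_of_lintegral _ fun f hf => ?_
  have hd := (hκ.measurable_driftDensity hw).ennreal_ofReal
  rw [lintegral_map hf measurable_fst, driftMeasure, lintegral_withDensity_eq_lintegral_mul _ hd
    (g := fun p => f p.1) (hf.comp measurable_fst), lintegral_prod _ (by fun_prop),
    lintegral_smul_measure, smul_eq_mul,
    ← lintegral_const_mul _ hf]
  refine lintegral_congr fun z => ?_
  simp only [Pi.mul_apply]
  rw [lintegral_mul_const (f := fun a => ENNReal.ofReal (driftDensity κ w (z, a))) _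
    (hd.comp measurable_prodMk_left)]
  congr 1
  have hi : Integrable (fun a => driftDensity κ w (z, a)) (ballMeasure E) :=
    Integrable.of_bound
      ((hκ.measurable_driftDensity hw).comp measurable_prodMk_left).aestronglyMeasurable 2
      (Eventually.of_forall fun a => by
        rw [Real.norm_of_nonneg (hκ.driftDensity_nonneg hw1 _)]; exact hκ.driftDensity_le hw1 _)
  rw [← ofReal_integral_eq_lintegral_ofReal hi
    (Eventually.of_forall fun a => hκ.driftDensity_nonneg hw1 _)]
  have hi2 : Integrable (fun a => fderiv ℝ κ a (w z)) (ballMeasure E) := by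
    have := hi.sub (integrable_const (1 : ℝ))
    refine this.congr (Eventually.of_forall fun a => ?_)
    simp [driftDensity]
  simp only [driftDensity]
  rw [integral_add (integrable_const _) hi2, hκ.integral_fderiv, add_zero, integral_const,
    smul_eq_mul, mul_one, measureReal_def, ENNReal.ofReal_toReal (measure_ne_top _ _)]

/-- If `w m` is divergence free, then the drift does not change the law of `z - h a`. -/
theorem IsProfile.map_fst_shiftMap_driftMeasure [IsFiniteMeasure m]
    (hκ : IsProfile κ) (hw : Measurable w)
    (hw1 : ∀ z, ‖w z‖ ≤ 1) {h : ℝ} (hh : h ≠ 0)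
    (hdiv : ∀ φ : E → ℝ, ContDiff ℝ ((⊤ : ℕ∞) : WithTop ℕ∞) φ → HasCompactSupport φ →
      ∫ z, fderiv ℝ φ z (w z) ∂m = 0) :
    ((driftMeasure m κ w).map (shiftMap h)).map Prod.fst =
      ((m.prod (ballMeasure E)).map (shiftMap h)).map Prod.fst := by
  have := hκ.isFiniteMeasure_driftMeasure (m := m) hw hw1
  have hs := measurable_shiftMap (E := E) h
  rw [Measure.map_map measurable_fst hs, Measure.map_map measurable_fst hs]
  refine Measure.ext_of_integral_eq_on_compactlySupported fun f => ?_
  have hf : Continuous f := f.continuous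
  have hm : Measurable (Prod.fst ∘ shiftMap (E := E) h) := measurable_fst.comp hs
  rw [integral_map hm.aemeasurable hf.aestronglyMeasurable,
    integral_map hm.aemeasurable hf.aestronglyMeasurable]
  obtain ⟨C, hC⟩ := f.hasCompactSupport.exists_bound_of_continuous hf
  rw [hκ.integral_driftMeasure_eq_add hw hw1 (F := fun p => f ((Prod.fst ∘ shiftMap h) p))
    (hf.measurable.comp hm) (Eventually.of_forall fun p => hC _)]
  obtain ⟨φ, h1, h2, h3⟩ := hκ.exists_fderiv_eq_integral hh hf f.hasCompactSupport
  have h4 := hdiv φ h1 h2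
  simp only [h3] at h4
  simp only [Function.comp_apply, shiftMap, h4, add_zero]

theorem ae_norm_snd_le_one :
    ∀ᵐ p ∂m.prod (ballMeasure E), ‖p.2‖ ≤ 1 := by
  refine Measure.quasiMeasurePreserving_snd.ae (p := fun a => ‖a‖ ≤ 1) ?_
  filter_upwards [ae_restrict_mem (μ := volume)
    (Metric.isClosed_closedBall (x := (0 : E)) (ε := 1)).measurableSet] with a ha
  simpa using ha

theorem ae_driftMeasure_norm_snd_le_one :
    ∀ᵐ p ∂driftMeasure m κ w, ‖p.2‖ ≤ 1 :=
  (withDensity_absolutelyContinuous _ _).ae_le ae_norm_snd_le_one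

theorem map_snd_shiftMap (h : ℝ) (μ : Measure (E × E)) :
    (μ.map (shiftMap h)).map Prod.snd = μ.map Prod.fst := by
  rw [Measure.map_map measurable_snd (measurable_shiftMap h)]
  rfl

theorem ae_map_shiftMap_norm_sub_le {h : ℝ} (hh : 0 ≤ h) {μ : Measure (E × E)}
    (hμ : ∀ᵐ p ∂μ, ‖p.2‖ ≤ 1) : ∀ᵐ p ∂μ.map (shiftMap h), ‖p.2 - p.1‖ ≤ h := by
  rw [ae_map_iff (measurable_shiftMap h).aemeasurable
    (measurableSet_le (by fun_prop) (by fun_prop))]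
  filter_upwards [hμ] with p hp
  simp only [shiftMap, sub_sub_cancel, norm_smul, Real.norm_of_nonneg hh]
  exact mul_le_of_le_one_right hh hp

theorem integral_inner_smul_prod_ballMeasure [IsFiniteMeasure m] {g : E → E} (hg : Measurable g)
    {C : ℝ} (hC : ∀ z, ‖g z‖ ≤ C) (h : ℝ) :
    ∫ p, inner ℝ (g p.1) (h • p.2) ∂m.prod (ballMeasure E) = 0 := by
  have hi : Integrable (fun p : E × E => inner ℝ (g p.1) (h • p.2))
      (m.prod (ballMeasure E)) := by
    refine Integrable.of_bound (C := C * |h|) (by fun_prop) ?_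
    filter_upwards [ae_norm_snd_le_one] with p hp
    refine (norm_inner_le_norm _ _).trans ?_
    rw [norm_smul, Real.norm_eq_abs]
    have hC0 : 0 ≤ C := (norm_nonneg _).trans (hC 0)
    calc ‖g p.1‖ * (|h| * ‖p.2‖) ≤ C * (|h| * 1) := by gcongr; exact hC _
      _ = C * |h| := by ring
  rw [integral_prod _ hi]
  simp only [inner_smul_right, integral_const_mul, integral_inner_ballMeasure, mul_zero,
    integral_zero]

theorem IsProfile.integral_inner_smul_driftMeasure [IsFiniteMeasure m] (hκ : IsProfile κ)
    (hw : Measurable w) (hw1 : ∀ z, ‖w z‖ ≤ 1) {g : E → E} (hg : Measurable g)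
    {C : ℝ} (hC : ∀ z, ‖g z‖ ≤ C) (h : ℝ) :
    ∫ p, inner ℝ (g p.1) (h • p.2) ∂driftMeasure m κ w =
      -(h * (∫ a, κ a) * ∫ z, inner ℝ (g z) (w z) ∂m) := by
  rw [hκ.integral_driftMeasure_eq_add hw hw1 (C := C * |h|) (by fun_prop),
    integral_inner_smul_prod_ballMeasure hg hC h, zero_add]
  · simp only [inner_smul_right, mul_assoc, integral_const_mul, hκ.integral_inner_mul_fderiv]
    rw [integral_neg, integral_mul_const]
    ring
  · filter_upwards [ae_norm_snd_le_one] with p hp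
    refine (abs_real_inner_le_norm _ _).trans ?_
    rw [norm_smul, Real.norm_eq_abs]
    have hC0 : 0 ≤ C := (norm_nonneg _).trans (hC 0)
    calc ‖g p.1‖ * (|h| * ‖p.2‖) ≤ C * (|h| * 1) := by gcongr; exact hC _
      _ = C * |h| := by ring

/-- The integrated form of cyclical monotonicity of a field `b` with respect to `m`. -/
def FlowMonotone (m : Measure E) (b : E → E) : Prop :=
  ∀ σ : Measure (E × E), IsFiniteMeasure σ → σ.map Prod.fst = σ.map Prod.snd →
    σ.map Prod.fst ≪ m → Integrable (fun p => inner ℝ (b p.1) (p.2 - p.1)) σ →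
      ∫ p, inner ℝ (b p.1) (p.2 - p.1) ∂σ ≤ 0

/-- Gluing at `x = z - h a` gives triples `((x, z), z')` with `z` from the tilted and `z'` from the
untilted law. Monotonicity applies to `(z, z')`; after replacing `b` by `g` and splitting at `x`,
the tilted half contributes the drift and the other half vanishes by symmetry. -/
theorem FlowMonotone.mul_integral_inner_le [IsFiniteMeasure m] {b : E → E}
    (hb : FlowMonotone m b) (hbm : Measurable b) (hbi : Integrable b m)
    (hκ : IsProfile κ) (hw : Measurable w) (hw1 : ∀ z, ‖w z‖ ≤ 1)
    (hdiv : ∀ φ : E → ℝ, ContDiff ℝ ((⊤ : ℕ∞) : WithTop ℕ∞) φ → HasCompactSupport φ →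
      ∫ z, fderiv ℝ φ z (w z) ∂m = 0)
    {g : E → E} (hg : Continuous g) (hgc : HasCompactSupport g) {h η : ℝ} (hh : 0 < h)
    (hη : ∀ x y, ‖x - y‖ ≤ 2 * h → ‖g x - g y‖ ≤ η) :
    (∫ a, κ a) * ∫ z, inner ℝ (g z) (w z) ∂m ≤
      (ballMeasure E Set.univ).toReal * (2 * (∫ z, ‖b z - g z‖ ∂m) + η * m.real Set.univ) := by
  obtain ⟨C, hC⟩ := hgc.exists_bound_of_continuous hg
  have hgm : Measurable g := hg.measurable
  have hgi : Integrable g m := Integrable.of_bound (by fun_prop) C (Eventually.of_forall hC)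
  have hfin := hκ.isFiniteMeasure_driftMeasure (m := m) hw hw1
  have hs := measurable_shiftMap (E := E) h
  set P := driftMeasure m κ w with hP
  set P₀ := m.prod (ballMeasure E) with hP₀
  set S := P.map (shiftMap h) with hS
  set S₀ := P₀.map (shiftMap h) with hS₀
  set Z := ballMeasure E Set.univ with hZ
  have hZtop : Z ≠ ∞ := measure_ne_top _ _
  have heq : S.map Prod.fst = S₀.map Prod.fst :=
    hκ.map_fst_shiftMap_driftMeasure hw hw1 hh.ne' hdiv
  set Θ := glue S S₀ with hΘ
  have hmm : Measurable (fun q : (E × E) × E => (q.1.1, q.2)) := by fun_prop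
  have hms : Measurable (fun q : (E × E) × E => (q.1.2, q.2)) := by fun_prop
  have hm12 : Measurable (fun q : (E × E) × E => q.1.2) := by fun_prop
  have m1 : Θ.map Prod.fst = S := map_fst_glue S S₀
  have m2 : Θ.map (fun q => (q.1.1, q.2)) = S₀ := map_snd_glue S S₀ heq
  have n1 : Θ.map (fun q => q.1.2) = Z • m := by
    rw [← hκ.map_fst_driftMeasure hw hw1, ← map_snd_shiftMap h, ← hP, ← hS, ← m1,
      Measure.map_map measurable_snd measurable_fst]
    rfl
  have n2 : Θ.map (fun q => q.2) = Z • m := by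
    rw [hZ, ← Measure.map_fst_prod (μ := m) (ν := ballMeasure E), ← map_snd_shiftMap h, ← hP₀,
      ← hS₀, ← m2, Measure.map_map measurable_snd hmm]
    rfl
  have a1 : ∀ᵐ q ∂Θ, ‖q.1.2 - q.1.1‖ ≤ h := by
    have := ae_map_shiftMap_norm_sub_le hh.le
      (ae_driftMeasure_norm_snd_le_one (m := m) (κ := κ) (w := w))
    rw [← hP, ← hS, ← m1] at this
    exact ae_of_ae_map measurable_fst.aemeasurable this
  have a2 : ∀ᵐ q ∂Θ, ‖q.2 - q.1.1‖ ≤ h := by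
    have := ae_map_shiftMap_norm_sub_le hh.le (ae_norm_snd_le_one (m := m))
    rw [← hP₀, ← hS₀, ← m2] at this
    exact ae_of_ae_map hmm.aemeasurable this
  have a3 : ∀ᵐ q ∂Θ, ‖q.2 - q.1.2‖ ≤ 2 * h := by
    filter_upwards [a1, a2] with q h1 h2
    calc ‖q.2 - q.1.2‖ = ‖(q.2 - q.1.1) - (q.1.2 - q.1.1)‖ := by congr 1; abel
      _ ≤ ‖q.2 - q.1.1‖ + ‖q.1.2 - q.1.1‖ := norm_sub_le _ _
      _ ≤ 2 * h := by linarith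
  have hb12 : Integrable (fun q : (E × E) × E => b q.1.2) Θ := by
    have : Integrable b (Θ.map fun q => q.1.2) := by
      rw [n1]; exact hbi.smul_measure hZtop
    exact this.comp_measurable hm12
  have hd12 : Integrable (fun q : (E × E) × E => ‖b q.1.2 - g q.1.2‖) Θ := by
    have : Integrable (fun z => ‖b z - g z‖) (Θ.map fun q => q.1.2) := by
      rw [n1]; exact (hbi.sub hgi).norm.smul_measure hZtop
    exact this.comp_measurable hm12
  have id12 : ∫ q, ‖b q.1.2 - g q.1.2‖ ∂Θ = Z.toReal * ∫ z, ‖b z - g z‖ ∂m := by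
    have := integral_map (μ := Θ) hm12.aemeasurable (f := fun z => ‖b z - g z‖) (by fun_prop)
    rw [← this, n1, integral_smul_measure, smul_eq_mul]
  have hI : Integrable (fun q : (E × E) × E => inner ℝ (b q.1.2) (q.2 - q.1.2)) Θ := by
    refine (hb12.norm.mul_const (2 * h)).mono' (by fun_prop) ?_
    filter_upwards [a3] with q hq
    exact (norm_inner_le_norm _ _).trans (by gcongr)
  have hneg : ∫ q, inner ℝ (b q.1.2) (q.2 - q.1.2) ∂Θ ≤ 0 := by
    have hmeas : AEStronglyMeasurable (fun p : E × E => inner ℝ (b p.1) (p.2 - p.1))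
        (Θ.map fun q => (q.1.2, q.2)) := by fun_prop
    have := hb (Θ.map fun q => (q.1.2, q.2)) inferInstance ?_ ?_ ?_
    · rwa [integral_map hms.aemeasurable hmeas] at this
    · rw [Measure.map_map measurable_fst hms, Measure.map_map measurable_snd hms]
      exact n1.trans n2.symm
    · rw [Measure.map_map measurable_fst hms]
      exact n1.symm ▸ Measure.smul_absolutelyContinuous
    · exact (integrable_map_measure hmeas hms.aemeasurable).2 hI
  have hi1 : Integrable (fun q : (E × E) × E => inner ℝ (g q.1.2) (q.1.1 - q.1.2)) Θ := by
    refine Integrable.of_bound (C := C * h) (by fun_prop) ?_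
    filter_upwards [a1] with q hq
    refine (norm_inner_le_norm _ _).trans ?_
    rw [norm_sub_rev] at hq
    gcongr
    · exact (norm_nonneg _).trans (hC 0)
    · exact hC _
  have hi2 : Integrable (fun q : (E × E) × E => inner ℝ (g q.2) (q.2 - q.1.1)) Θ := by
    refine Integrable.of_bound (C := C * h) (by fun_prop) ?_
    filter_upwards [a2] with q hq
    refine (norm_inner_le_norm _ _).trans ?_
    gcongr
    · exact (norm_nonneg _).trans (hC 0)
    · exact hC _
  have j1 : ∫ q, inner ℝ (g q.1.2) (q.1.1 - q.1.2) ∂Θ =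
      h * (∫ a, κ a) * ∫ z, inner ℝ (g z) (w z) ∂m := by
    have e1 := integral_map (μ := Θ) measurable_fst.aemeasurable
      (f := fun p : E × E => (inner ℝ (g p.2) (p.1 - p.2) : ℝ)) (by fun_prop)
    rw [← e1, m1, hS, integral_map hs.aemeasurable (by fun_prop)]
    have e2 := hκ.integral_inner_smul_driftMeasure (m := m) hw hw1 hgm hC h
    rw [← hP] at e2
    rw [← neg_eq_iff_eq_neg] at e2
    rw [← e2, ← integral_neg]
    refine integral_congr_ae (Eventually.of_forall fun p => ?_)
    simp only [shiftMap, sub_sub_cancel_left, inner_neg_right]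
  have j2 : ∫ q, inner ℝ (g q.2) (q.2 - q.1.1) ∂Θ = 0 := by
    have e1 := integral_map (μ := Θ) hmm.aemeasurable
      (f := fun p : E × E => (inner ℝ (g p.2) (p.2 - p.1) : ℝ)) (by fun_prop)
    rw [← e1, m2, hS₀, integral_map hs.aemeasurable (by fun_prop)]
    simp only [shiftMap, sub_sub_cancel]
    exact integral_inner_smul_prod_ballMeasure hgm hC h
  -- The errors are `b - g`, over a displacement of at most `2h`, and the oscillation of `g` between
  -- `z` and `z'`, over at most `h`. All terms are of order `h`, so `h` divides out.
  have hlow : ∀ᵐ q ∂Θ, inner ℝ (g q.1.2) (q.1.1 - q.1.2) + inner ℝ (g q.2) (q.2 - q.1.1) -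
      2 * h * ‖b q.1.2 - g q.1.2‖ - η * h ≤ inner ℝ (b q.1.2) (q.2 - q.1.2) := by
    filter_upwards [a2, a3] with q h2 h3
    have e : inner ℝ (b q.1.2) (q.2 - q.1.2) = inner ℝ (g q.1.2) (q.1.1 - q.1.2) +
        inner ℝ (g q.2) (q.2 - q.1.1) + inner ℝ (b q.1.2 - g q.1.2) (q.2 - q.1.2) -
        inner ℝ (g q.2 - g q.1.2) (q.2 - q.1.1) := by
      simp only [inner_sub_left, inner_sub_right]; ring
    have f1 : |inner ℝ (b q.1.2 - g q.1.2) (q.2 - q.1.2)| ≤ ‖b q.1.2 - g q.1.2‖ * (2 * h) :=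
      (abs_real_inner_le_norm _ _).trans (by gcongr)
    have f2 : |inner ℝ (g q.2 - g q.1.2) (q.2 - q.1.1)| ≤ η * h := by
      have hg' := hη _ _ h3
      exact (abs_real_inner_le_norm _ _).trans
        (mul_le_mul hg' h2 (norm_nonneg _) ((norm_nonneg _).trans hg'))
    rw [e]
    linarith [(abs_le.1 f1).1, (abs_le.1 f2).2]
  have hi12 : Integrable (fun q : (E × E) × E => inner ℝ (g q.1.2) (q.1.1 - q.1.2) +
      inner ℝ (g q.2) (q.2 - q.1.1)) Θ := hi1.add hi2
  have hi123 : Integrable (fun q : (E × E) × E => inner ℝ (g q.1.2) (q.1.1 - q.1.2) +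
      inner ℝ (g q.2) (q.2 - q.1.1) - 2 * h * ‖b q.1.2 - g q.1.2‖) Θ :=
    hi12.sub (hd12.const_mul (2 * h))
  have hfinal := integral_mono_ae (hi123.sub (integrable_const (η * h))) hI hlow
  have hmass : Θ.real Set.univ = Z.toReal * m.real Set.univ := by
    have : Θ Set.univ = Z * m Set.univ := by
      rw [← smul_eq_mul, ← Measure.smul_apply, ← n2, Measure.map_apply measurable_snd .univ]
      rfl
    rw [measureReal_def, this, ENNReal.toReal_mul, measureReal_def]
  have hcomp : ∫ q, (inner ℝ (g q.1.2) (q.1.1 - q.1.2) + inner ℝ (g q.2) (q.2 - q.1.1) -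
      2 * h * ‖b q.1.2 - g q.1.2‖ - η * h) ∂Θ =
      h * (∫ a, κ a) * (∫ z, inner ℝ (g z) (w z) ∂m) + 0 -
        2 * h * (Z.toReal * ∫ z, ‖b z - g z‖ ∂m) - Z.toReal * m.real Set.univ * (η * h) := by
    rw [integral_sub hi123 (integrable_const _), integral_sub hi12 (hd12.const_mul _),
      integral_add hi1 hi2, integral_const_mul, j1, j2, id12, integral_const, hmass, smul_eq_mul]
  have hle := (hcomp.symm.trans_le hfinal).trans hneg
  refine le_of_mul_le_mul_left ?_ hh
  linarith

/-- Approximate `b` in `L¹(m)` by `g`, then choose `h` from the uniform continuity of `g`; both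
errors vanish while `∫ κ > 0` stays fixed. -/
theorem FlowMonotone.integral_inner_nonpos [IsFiniteMeasure m] {b : E → E}
    (hb : FlowMonotone m b) (hbm : Measurable b) (hbi : Integrable b m)
    (hw : Measurable w) (hw1 : ∀ z, ‖w z‖ ≤ 1)
    (hdiv : ∀ φ : E → ℝ, ContDiff ℝ ((⊤ : ℕ∞) : WithTop ℕ∞) φ → HasCompactSupport φ →
      ∫ z, fderiv ℝ φ z (w z) ∂m = 0) :
    ∫ z, inner ℝ (b z) (w z) ∂m ≤ 0 := by
  obtain ⟨κ, hκ⟩ := exists_isProfile E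
  set K := ∫ a, κ a with hK
  set Z := (ballMeasure E Set.univ).toReal with hZ
  set M := m.real Set.univ with hM
  have hK0 : 0 < K := hκ.integral_pos
  have hZ0 : 0 ≤ Z := ENNReal.toReal_nonneg
  have hM0 : 0 ≤ M := measureReal_nonneg
  have hint : ∀ f : E → E, Integrable f m → Integrable (fun z => (inner ℝ (f z) (w z) : ℝ)) m :=
    fun f hf => hf.norm.mono' (hf.1.inner hw.aestronglyMeasurable)
      (Eventually.of_forall fun z => (norm_inner_le_norm _ _).trans
        (mul_le_of_le_one_right (norm_nonneg _) (hw1 z)))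
  have key : ∀ ε : ℝ, 0 < ε → K * (∫ z, inner ℝ (b z) (w z) ∂m) ≤ ε * (K + 2 * Z + Z * M) := by
    intro ε hε
    obtain ⟨g, hgc, hgb, hg, hgi⟩ := hbi.exists_hasCompactSupport_integral_sub_le hε
    have huc : UniformContinuous g := hgc.uniformContinuous_of_continuous hg
    obtain ⟨δ, hδ, hgδ⟩ := Metric.uniformContinuous_iff.1 huc ε hε
    have hη : ∀ x y, ‖x - y‖ ≤ 2 * (δ / 4) → ‖g x - g y‖ ≤ ε := fun x y hxy => by
      rw [← dist_eq_norm] at hxy ⊢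
      exact (hgδ (by linarith)).le
    have h1 := hb.mul_integral_inner_le hbm hbi hκ hw hw1 hdiv hg hgc (by positivity) hη
    have h2 : (∫ z, inner ℝ (b z) (w z) ∂m) - ∫ z, inner ℝ (g z) (w z) ∂m ≤ ε := by
      rw [← integral_sub (hint b hbi) (hint g hgi)]
      refine (integral_mono ((hint b hbi).sub (hint g hgi)) (hbi.sub hgi).norm fun z => ?_).trans
        hgb
      simp only [Pi.sub_apply, ← inner_sub_left]
      exact (real_inner_le_norm _ _).trans (mul_le_of_le_one_right (norm_nonneg _) (hw1 z))
    have h3 : Z * (2 * (∫ z, ‖b z - g z‖ ∂m) + ε * M) ≤ Z * (2 * ε + ε * M) := by gcongr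
    have h4 := mul_le_mul_of_nonneg_left h2 hK0.le
    linarith
  by_contra hcon
  push Not at hcon
  set I := ∫ z, inner ℝ (b z) (w z) ∂m
  have hA : 0 < K + 2 * Z + Z * M := by positivity
  -- With this `ε` the bound reads `K * I ≤ K * I / 2`, impossible for `I > 0`.
  have := key (K * I / (2 * (K + 2 * Z + Z * M))) (by positivity)
  have e : K * I / (2 * (K + 2 * Z + Z * M)) * (K + 2 * Z + Z * M) = K * I / 2 := by
    field_simp
  rw [e] at this
  have : 0 < K * I := by positivity
  linarith

end Perturbation

/-! ### Tangency by orthogonality, and conclusion -/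

section Tangent

variable {μ ν : WSpace D}

theorem inner_gradient_eq_fderiv (φ : Euc D → ℝ) (x v : Euc D) :
    inner ℝ (gradient φ x) v = fderiv ℝ φ x v :=
  InnerProductSpace.toDual_symm_apply

theorem gradient_add_of_contDiff {φ χ : Euc D → ℝ}
    (hφ : ContDiff ℝ ((⊤ : ℕ∞) : WithTop ℕ∞) φ) (hχ : ContDiff ℝ ((⊤ : ℕ∞) : WithTop ℕ∞) χ) :
    gradient (φ + χ) = gradient φ + gradient χ := by
  ext1 x
  simp only [gradient, Pi.add_apply,
    fderiv_add (hφ.differentiable (by simp) x) (hχ.differentiable (by simp) x), map_add]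

theorem gradient_const_smul_of_contDiff {φ : Euc D → ℝ}
    (hφ : ContDiff ℝ ((⊤ : ℕ∞) : WithTop ℕ∞) φ) (c : ℝ) :
    gradient (c • φ) = c • gradient φ := by
  ext1 x
  simp only [gradient, Pi.smul_apply, fderiv_const_smul (hφ.differentiable (by simp) x), map_smul]

/-- The subspace of gradients of test functions, whose closure is the tangent space. -/
def gradientSpace (μ : WSpace D) : Submodule ℝ (L2 μ) where
  carrier := {f : L2 μ | ∃ φ : Euc D → ℝ,
    ContDiff ℝ ((⊤ : ℕ∞) : WithTop ℕ∞) φ ∧ HasCompactSupport φ ∧ f =ᵐ[μ.1] gradient φ}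
  add_mem' := by
    rintro f g ⟨φ, h1, h2, h3⟩ ⟨χ, k1, k2, k3⟩
    refine ⟨φ + χ, h1.add k1, h2.add k2, ?_⟩
    rw [gradient_add_of_contDiff h1 k1]
    exact (Lp.coeFn_add f g).trans (h3.add k3)
  zero_mem' := by
    refine ⟨0, contDiff_const, HasCompactSupport.zero, ?_⟩
    have : gradient (0 : Euc D → ℝ) = 0 := by
      ext1 x; simp [gradient]
    rw [this]
    exact Lp.coeFn_zero _ _ _
  smul_mem' := by
    rintro c f ⟨φ, h1, h2, h3⟩
    refine ⟨c • φ, h1.const_smul c, h2.smul_left (f := fun _ => c), ?_⟩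
    rw [gradient_const_smul_of_contDiff h1]
    exact (Lp.coeFn_smul c f).trans (h3.const_smul c)

theorem tangentSpace_eq_orthogonal (μ : WSpace D) :
    tangentSpace μ = ((gradientSpace μ)ᗮᗮ : Submodule ℝ (L2 μ)) := by
  rw [Submodule.orthogonal_orthogonal_eq_closure, Submodule.topologicalClosure_coe]
  rfl

theorem integral_fderiv_eq_zero_of_mem_orthogonal {w : L2 μ} (hw : w ∈ (gradientSpace μ)ᗮ)
    {φ : Euc D → ℝ} (hφ : ContDiff ℝ ((⊤ : ℕ∞) : WithTop ℕ∞) φ) (hc : HasCompactSupport φ) :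
    ∫ z, fderiv ℝ φ z (w z) ∂μ.1 = 0 := by
  have hfd : Continuous (fderiv ℝ φ) := hφ.continuous_fderiv (by simp)
  have hgc : Continuous (gradient φ) :=
    (InnerProductSpace.toDual ℝ (Euc D)).symm.continuous.comp hfd
  obtain ⟨C, hC⟩ := (hc.fderiv (𝕜 := ℝ)).exists_bound_of_continuous hfd
  have hL : MemLp (gradient φ) 2 μ.1 := MemLp.of_bound hgc.aestronglyMeasurable C
    (Eventually.of_forall fun x => by
      rw [gradient, LinearIsometryEquiv.norm_map]; exact hC x)
  have h := (Submodule.mem_orthogonal _ _).1 hw hL.toLp ⟨φ, hφ, hc, hL.coeFn_toLp⟩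
  rw [L2.inner_def] at h
  rw [← h]
  refine integral_congr_ae ?_
  filter_upwards [hL.coeFn_toLp] with x hx
  rw [hx, inner_gradient_eq_fderiv]

/-- The weight `1 + ‖w‖` trades the unbounded field for one bounded by one without changing the
vector measure `w μ`; `b` is integrable for the new measure because `b` and `w` are both in `L²(μ)`.
-/
theorem PlanMonotone.integral_inner_nonpos {b : Euc D → Euc D} (hbm : Measurable b)
    (hb : MemLp b 2 μ.1) (hmono : PlanMonotone μ b) {w : L2 μ} (hw : w ∈ (gradientSpace μ)ᗮ) :
    ∫ z, inner ℝ (b z) (w z) ∂μ.1 ≤ 0 := by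
  have hwm : Measurable w := (Lp.stronglyMeasurable w).measurable
  have hwL : MemLp w 2 μ.1 := Lp.memLp w
  have hd : Measurable fun z => 1 + ‖w z‖ := measurable_const.add hwm.norm
  have hpos : ∀ z, 0 < 1 + ‖w z‖ := fun z => by positivity
  set m := μ.1.withDensity fun z => ENNReal.ofReal (1 + ‖w z‖) with hm
  have hmfin : IsFiniteMeasure m := isFiniteMeasure_withDensity_ofReal
    ((integrable_const (1 : ℝ)).add (hwL.integrable (by norm_num)).norm).2
  have hac : m ≪ μ.1 := withDensity_absolutelyContinuous _ _
  have hconv : ∀ F : Euc D → ℝ, ∫ z, F z ∂m = ∫ z, (1 + ‖w z‖) * F z ∂μ.1 := fun F => by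
    rw [hm, integral_withDensity_eq_integral_toReal_smul hd.ennreal_ofReal
      (Eventually.of_forall fun _ => ENNReal.ofReal_lt_top)]
    simp only [ENNReal.toReal_ofReal (hpos _).le, smul_eq_mul]
  have hbi : Integrable b m := by
    rw [hm, integrable_withDensity_iff_integrable_smul' hd.ennreal_ofReal
      (Eventually.of_forall fun _ => ENNReal.ofReal_lt_top)]
    simp only [ENNReal.toReal_ofReal (hpos _).le]
    have h1 : Integrable (fun z => ‖b z‖ + ‖w z‖ * ‖b z‖) μ.1 :=
      (hb.integrable (by norm_num)).norm.add (hwL.norm.integrable_mul hb.norm)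
    refine h1.mono' (by fun_prop) (Eventually.of_forall fun z => ?_)
    rw [norm_smul, Real.norm_of_nonneg (hpos z).le]
    linarith
  let w' : Euc D → Euc D := fun z => (1 + ‖w z‖)⁻¹ • w z
  have hw'm : Measurable w' := hd.inv.smul hwm
  have hw'1 : ∀ z, ‖w' z‖ ≤ 1 := fun z => by
    simp only [w', norm_smul, norm_inv, Real.norm_of_nonneg (hpos z).le]
    rw [inv_mul_le_iff₀ (hpos z)]
    linarith
  have hflow : FlowMonotone m b := fun σ _ heq hσ hint =>
    hmono.integral_nonpos hbm hb heq (hσ.trans hac) hint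
  have key := hflow.integral_inner_nonpos hbm hbi hw'm hw'1 fun φ hφ hc => by
    rw [hconv, ← integral_fderiv_eq_zero_of_mem_orthogonal hw hφ hc]
    refine integral_congr_ae (Eventually.of_forall fun z => ?_)
    simp only [w', map_smul, smul_eq_mul, mul_inv_cancel_left₀ (hpos z).ne']
  rw [hconv] at key
  simpa only [w', inner_smul_right, mul_inv_cancel_left₀ (hpos _).ne'] using key

theorem PlanMonotone.integral_inner_eq_zero {b : Euc D → Euc D} (hbm : Measurable b)
    (hb : MemLp b 2 μ.1) (hmono : PlanMonotone μ b) {w : L2 μ} (hw : w ∈ (gradientSpace μ)ᗮ) :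
    ∫ z, inner ℝ (b z) (w z) ∂μ.1 = 0 := by
  refine le_antisymm (hmono.integral_inner_nonpos hbm hb hw) ?_
  have h := hmono.integral_inner_nonpos hbm hb (Submodule.neg_mem _ hw)
  have e : ∫ z, inner ℝ (b z) ((-w : L2 μ) z) ∂μ.1 = -∫ z, inner ℝ (b z) (w z) ∂μ.1 := by
    rw [← integral_neg]
    refine integral_congr_ae ?_
    filter_upwards [Lp.coeFn_neg w] with z hz
    rw [hz, Pi.neg_apply, inner_neg_right]
  rw [e] at h
  linarith

/-- Multiples of `Id - b`, for the barycentric projection `b` of an optimal plan, are tangent. -/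
theorem mem_tangentSpace {γ : Measure (Euc D × Euc D)} [IsFiniteMeasure γ]
    (hγ : γ ∈ optimalPlans μ ν) {ξ : L2 μ} (c : ℝ)
    (hξ : ξ =ᵐ[μ.1] fun x => c • (x - bary γ x)) : ξ ∈ tangentSpace μ := by
  rw [tangentSpace_eq_orthogonal]
  refine (Submodule.mem_orthogonal' _ _).2 fun w hw => ?_
  have hb := memLp_bary_of_mem_plans hγ.1
  have hwL : MemLp w 2 μ.1 := Lp.memLp w
  have h1 := (planMonotone_id μ).integral_inner_eq_zero measurable_id μ.memLp hw
  have h2 := (planMonotone_bary hγ).integral_inner_eq_zero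
    (stronglyMeasurable_bary γ).measurable hb hw
  rw [L2.inner_def]
  have e : ∫ z, inner ℝ (ξ z) (w z) ∂μ.1 =
      c * ((∫ z, inner ℝ (id z) (w z) ∂μ.1) - ∫ z, inner ℝ (bary γ z) (w z) ∂μ.1) := by
    rw [← integral_sub (integrable_inner_of_memLp (f := id) μ.memLp hwL)
      (integrable_inner_of_memLp hb hwL), ← integral_const_mul]
    refine integral_congr_ae ?_
    filter_upwards [hξ] with z hz
    rw [hz, inner_smul_left, inner_sub_left]
    rfl
  rw [e, h1, h2, sub_zero, mul_zero]

theorem memLp_smul_sub_of_isBarycentricFst {γ : Measure (Euc D × Euc D)} [IsFiniteMeasure γ]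
    (hγ : γ ∈ plans μ ν) {b : Euc D → Euc D} (hb : IsBarycentricFst γ μ b) (c : ℝ) :
    MemLp (fun x => c • (x - b x)) 2 μ.1 :=
  (μ.memLp.sub ((memLp_congr_ae (hb.ae_eq (isBarycentricFst_bary hγ))).2
    (memLp_bary_of_mem_plans hγ))).const_smul c

/-- The barycentric projections of an optimal plan between `μ` and a minimizer `ν` exist, and they
give a tangent supergradient of `H_τ` at `μ` and a tangent subgradient of `H` at `ν`. -/
theorem optimalPlan_differentials {H : WSpace D → EReal} (hH : Proper H) {τ : ℝ} (hτ : 0 < τ)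
    (hν : ν ∈ minimizers τ H μ) (γ : Measure (Euc D × Euc D)) (hγ : γ ∈ optimalPlans μ ν) :
    (∃ b, IsBarycentricFst γ μ b) ∧
    (∃ c, IsBarycentricSnd γ ν c) ∧
    (∀ b, IsBarycentricFst γ μ b →
      ∃ hb : MemLp (fun x => τ⁻¹ • (x - b x)) 2 μ.1,
        hb.toLp ∈ superdifferential (moreauYosida τ H) μ ∩ tangentSpace μ) ∧
    (∀ c, IsBarycentricSnd γ ν c →
      ∃ hc : MemLp (fun y => τ⁻¹ • (c y - y)) 2 ν.1,
        hc.toLp ∈ subdifferential H ν ∩ tangentSpace ν) := by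
  have hp := isProbabilityMeasure_of_mem_plans hγ.1
  have hγ' := map_swap_mem_optimalPlans hγ
  have hp' := isProbabilityMeasure_of_mem_plans hγ'.1
  refine ⟨⟨_, isBarycentricFst_bary hγ.1⟩,
    ⟨_, isBarycentricSnd_iff.2 (isBarycentricFst_bary hγ'.1)⟩, fun b hb => ?_, fun c hc => ?_⟩
  · have hL := memLp_smul_sub_of_isBarycentricFst hγ.1 hb τ⁻¹
    have hξ : hL.toLp =ᵐ[μ.1] fun x => τ⁻¹ • (x - bary γ x) := by
      filter_upwards [hL.coeFn_toLp, hb.ae_eq (isBarycentricFst_bary hγ.1)] with x h1 h2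
      rw [h1, h2]
    exact ⟨hL, mem_superdifferential hH hτ hν hγ hξ, mem_tangentSpace hγ τ⁻¹ hξ⟩
  · rw [isBarycentricSnd_iff] at hc
    have hneg : (fun y => τ⁻¹ • (c y - y)) = fun y => -τ⁻¹ • (y - c y) := by
      ext1 y; rw [neg_smul, ← smul_neg, neg_sub]
    have hL : MemLp (fun y => τ⁻¹ • (c y - y)) 2 ν.1 := by
      rw [hneg]; exact memLp_smul_sub_of_isBarycentricFst hγ'.1 hc (-τ⁻¹)
    have hae := hc.ae_eq (isBarycentricFst_bary hγ'.1)
    refine ⟨hL, mem_subdifferential hH hτ hν hγ' ?_, mem_tangentSpace hγ' (-τ⁻¹) ?_⟩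
    · filter_upwards [hL.coeFn_toLp, hae] with x h1 h2
      rw [h1, h2]
    · filter_upwards [hL.coeFn_toLp, hae] with x h1 h2
      rw [h1, h2, neg_smul, ← smul_neg, neg_sub]

end Tangent

end

end WassersteinMY

theorem mainTheorem4 (D : ℕ) (H : WassersteinMY.WSpace D → EReal) (hH : WassersteinMY.Proper H)
    (τ : ℝ) (hτ : 0 < τ) (μₒ νₒ : WassersteinMY.WSpace D)
    (hν : νₒ ∈ WassersteinMY.minimizers τ H μₒ) :
    (WassersteinMY.superdifferential (WassersteinMY.moreauYosida τ H) μₒ).Nonempty ∧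
    (WassersteinMY.subdifferential H νₒ).Nonempty ∧
    ∀ γ ∈ WassersteinMY.optimalPlans μₒ νₒ,
      (∃ b, WassersteinMY.IsBarycentricFst γ μₒ b) ∧
      (∃ c, WassersteinMY.IsBarycentricSnd γ νₒ c) ∧
      (∀ b, WassersteinMY.IsBarycentricFst γ μₒ b →
        ∃ hb : MemLp (fun x => τ⁻¹ • (x - b x)) 2 μₒ.1,
          hb.toLp ∈ WassersteinMY.superdifferential (WassersteinMY.moreauYosida τ H) μₒ ∩
            WassersteinMY.tangentSpace μₒ) ∧
      (∀ c, WassersteinMY.IsBarycentricSnd γ νₒ c →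
        ∃ hc : MemLp (fun y => τ⁻¹ • (c y - y)) 2 νₒ.1,
          hc.toLp ∈ WassersteinMY.subdifferential H νₒ ∩
            WassersteinMY.tangentSpace νₒ) := by
  have main := WassersteinMY.optimalPlan_differentials hH hτ hν
  obtain ⟨γ, hγ⟩ := WassersteinMY.exists_mem_optimalPlans μₒ νₒ
  obtain ⟨⟨b, hb⟩, ⟨c, hc⟩, h1, h2⟩ := main γ hγ
  obtain ⟨_, hb'⟩ := h1 b hb
  obtain ⟨_, hc'⟩ := h2 c hc
  exact ⟨⟨_, hb'.1⟩, ⟨_, hc'.1⟩, main⟩
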